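/- **Setting.** Fix $\beta\in[0,2)$ and put $h=(2-\beta)\pi^2$. For $N_t\in\mathbb N$ let $T=\sqrt{N_t h/4}$ and let $$r_t(z)=\frac{zh}{\pi}\sum_{j=1}^{N_t}\frac{1}{\sqrt{jh}}\;\frac{e^{\sqrt{jh}-T}}{e^{2\sqrt{jh}-2T}+z}$$ be the rational approximant of $\sqrt z$ (principal branch) obtained from the trapezoidal rule. Let $$f(u,z)=\frac{z}{\pi}\,\frac{1}{\sqrt u}\,\frac{e^{\sqrt u-T}}{e^{2(\sqrt u-T)}+z},\qquad \delta(u)=\mu(u)+\frac{i}{2}\cot\Big(\frac{\pi u}{h}\Big),$$ where $\mu(u)=-\tfrac12$ if $\operatorname{Im}u\ge 0$ and $\mu(u)=\tfrac12$ if $\operatorname{Im}u<0$. For $r\in(0,1]$ let $\Gamma$ be the positively oriented boundary of the rectangle $[1-\beta/2,\;4T^2+1-\beta/2]\times[-ai,ai]$ with $a=2\pi\,(T+\tfrac12\log r)$. **Conjectured bound (hypothesis).** There are constants $C'$ and $N_0'$, depending only on $\beta$, such that for all $N_t\ge N_0'$, all $r\in[e^{4+2\beta-2T},1]$ and both $z=re^{\pm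 i\beta\pi/2}$, $$\Big|\int_\Gamma f(u,z)\,\delta(u)\,du\Big|\le C' e^{-T}.$$ **Theorem.** Let $\beta\in[0,2)$ and assume that the conjectured bound holds for this $\beta$. Then $$|r_t(z)-\sqrt z\,|=\mathcal O\big(e^{-\sqrt{N_t h/4}}\big)=\mathcal O\big(e^{-\pi\sqrt{(2-\beta)N_t/4}}\big)\qquad\text{as } N_t\to\infty,$$ uniformly for $z$ in the V-shaped domain $[0,1]e^{\pm i\beta\pi/2}=\{re^{i\beta\pi/2}: 0\le r\le 1\}\cup\{re^{-i\beta\pi/2}:0\le r\le 1\}$. That is, there are constants $C$ and $N_0$, depending only on $\beta$, such that $|r_t(z)-\sqrt z\,|\le C e^{-\pi\sqrt{(2-\beta)N_t/4}}$ for all $N_t\ge N_0$ and all $z$ in this domain. -/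

import Mathlib

open Set

noncomputable section

namespace TrapSqrt

/-- The V-shaped domain `[0,1] e^{± iβπ/2}` : two copies of the unit interval, rotated about the
origin by the angles `βπ/2` and `-βπ/2`. -/
def vDomain (β : ℝ) : Set ℂ :=
  {z | ∃ r ∈ Icc (0 : ℝ) 1,
    z = (r : ℂ) * Complex.exp (((β * Real.pi / 2 : ℝ) : ℂ) * Complex.I) ∨
    z = (r : ℂ) * Complex.exp (-((β * Real.pi / 2 : ℝ) : ℂ) * Complex.I)}

/-- The truncation parameter `T = √(N h / 4)`. -/
def truncT (h : ℝ) (N : ℕ) : ℝ := Real.sqrt (N * h / 4)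

/-- The rational approximant of `√z` obtained from the trapezoidal rule with step `h` and
`N` nodes:
`r_t(z) = (z h / π) ∑_{j=1}^N (1 / √(jh)) e^{√(jh) - T} / (e^{2√(jh) - 2T} + z)`,
where `T = √(N h / 4)`. -/
def trapApprox (h : ℝ) (N : ℕ) (z : ℂ) : ℂ :=
  z * (h : ℂ) / (Real.pi : ℂ) * ∑ j ∈ Finset.Icc 1 N,
    (1 / (Real.sqrt (j * h) : ℂ)) *
      ((Real.exp (Real.sqrt (j * h) - truncT h N) : ℂ) /
        ((Real.exp (2 * Real.sqrt (j * h) - 2 * truncT h N) : ℂ) + z))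

/-- The step size `h = (2 - β) π²`. -/
def stepSize (β : ℝ) : ℝ := (2 - β) * Real.pi ^ 2

/-- The integrand `f(u, z) = (z / π) (1 / √u) e^{√u - T} / (e^{2(√u - T)} + z)`, with the principal
branch of `√u`. -/
def integrand (T : ℝ) (u z : ℂ) : ℂ :=
  z / (Real.pi : ℂ) * (1 / Complex.sqrt u) *
    (Complex.exp (Complex.sqrt u - (T : ℂ)) /
      (Complex.exp (2 * (Complex.sqrt u - (T : ℂ))) + z))

/-- `μ(u) = -1/2` if `Im u ≥ 0` and `μ(u) = 1/2` if `Im u < 0`. -/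
def muFun (u : ℂ) : ℂ := if 0 ≤ u.im then -(1 / 2) else 1 / 2

/-- `m(u) = -(i/2) cot(π u / h)`. -/
def mFun (h : ℝ) (u : ℂ) : ℂ :=
  -(Complex.I / 2) * Complex.cot ((Real.pi : ℂ) * u / (h : ℂ))

/-- `δ(u) = μ(u) - m(u)`. -/
def deltaFun (h : ℝ) (u : ℂ) : ℂ := muFun u - mFun h u

/-- The contour integral of `g` over the positively oriented boundary of the rectangle
`[x₀, x₁] × [y₀ i, y₁ i]` : bottom, right, top and left side. -/
def rectIntegral (g : ℂ → ℂ) (x₀ x₁ y₀ y₁ : ℝ) : ℂ :=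
  (∫ x in x₀..x₁, g (x + y₀ * Complex.I))
    + Complex.I * (∫ y in y₀..y₁, g (x₁ + y * Complex.I))
    - (∫ x in x₀..x₁, g (x + y₁ * Complex.I))
    - Complex.I * (∫ y in y₀..y₁, g (x₀ + y * Complex.I))

/-- The integral `∫_Γ f(u, z) δ(u) du` for `|z| = r`, over the positively oriented rectangle
`Γ = [1 - β/2, 4T² + 1 - β/2] × [-ai, ai]` with `a = 2π (T + ½ log r)`,
where `h = (2 - β) π²` and `T = √(N h / 4)`. -/
def contourTerm (β : ℝ) (N : ℕ) (r : ℝ) (z : ℂ) : ℂ :=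
  rectIntegral
    (fun u => integrand (truncT (stepSize β) N) u z * deltaFun (stepSize β) u)
    (1 - β / 2) (4 * truncT (stepSize β) N ^ 2 + 1 - β / 2)
    (-(2 * Real.pi * (truncT (stepSize β) N + 1 / 2 * Real.log r)))
    (2 * Real.pi * (truncT (stepSize β) N + 1 / 2 * Real.log r))

/-- The conjectured bound for a fixed `β`: `|∫_Γ f(u, z) δ(u) du| = O(e^{-T})` as `N → ∞`,
uniformly for `z = r e^{± iβπ/2}` with `r ∈ [e^{4 + 2β - 2T}, 1]`. -/
def ContourBound (β : ℝ) : Prop :=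
  ∃ C : ℝ, ∃ N₀ : ℕ, ∀ N : ℕ, N₀ ≤ N →
    ∀ r ∈ Icc (Real.exp (4 + 2 * β - 2 * truncT (stepSize β) N)) 1, ∀ z : ℂ,
      (z = (r : ℂ) * Complex.exp (((β * Real.pi / 2 : ℝ) : ℂ) * Complex.I) ∨
        z = (r : ℂ) * Complex.exp (-((β * Real.pi / 2 : ℝ) : ℂ) * Complex.I)) →
      ‖contourTerm β N r z‖ ≤ C * Real.exp (-truncT (stepSize β) N)

end TrapSqrt

end

open Set Filter Topology

noncomputable section

namespace TrapSqrt

/-! The substitution `t = e^{√u - T}` turns `f(u, z) du` into `(2/π) z / (t² + z) dt`, whose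
integral over `(0, ∞)` is `√z`, while `r_t(z)` equals `h ∑ f(jh, z)`, a quadrature sum for the same
integral. Cutting `u` to `[1 - β/2, 4T² + 1 - β/2]` cuts `t` at about `e^{-T}` and `e^T`, which
costs `O(e^{-T})` (`norm_integral_integrand_sub_sqrt_le`).

The quadrature error comes from residues. The function `m` has residue `h/(2πi)` at every node, so
integrating `f m` around `Γ` yields the sum, and integrating `f μ` yields the integral over the real
segment. Hence the integral of `f δ` is the quadrature error plus corrections from the two poles of
`f` inside `Γ` (`rectIntegral_integrand_mul_deltaFun`). With `τ = T + ½ log r`, the residue of `f`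
at a pole has size of order `e^{τ - T}`, and `h` is chosen so that `δ` there is at most `2e^{-τ}`;
each correction is `O(e^{-T})` (`norm_pole_contribution_le`). The remaining contour integral is the
hypothesis.

This requires `τ ≥ 2 + β`, so that the poles lie inside `Γ`. For smaller `r`, both `√z` and `r_t(z)`
are themselves `O(e^{-T})` (`norm_trapApprox_sub_sqrt_le_of_small`). -/

/-- The boundary of the rectangle `[x₀, x₁] × [y₀ i, y₁ i]`. -/
def rectBoundary (x₀ x₁ y₀ y₁ : ℝ) : Set ℂ :=
  {u | u ∈ Icc x₀ x₁ ×ℂ Icc y₀ y₁ ∧ (u.re = x₀ ∨ u.re = x₁ ∨ u.im = y₀ ∨ u.im = y₁)}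

/-- Interval integrability on each of the four sides of a rectangle. -/
structure RectIntegrable (g : ℂ → ℂ) (x₀ x₁ y₀ y₁ : ℝ) : Prop where
  bottom : IntervalIntegrable (fun x : ℝ => g (x + y₀ * Complex.I)) MeasureTheory.volume x₀ x₁
  right : IntervalIntegrable (fun y : ℝ => g (x₁ + y * Complex.I)) MeasureTheory.volume y₀ y₁
  top : IntervalIntegrable (fun x : ℝ => g (x + y₁ * Complex.I)) MeasureTheory.volume x₀ x₁
  left : IntervalIntegrable (fun y : ℝ => g (x₀ + y * Complex.I)) MeasureTheory.volume y₀ y₁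

/-! ### Residue theorem for simple poles in a rectangle -/

section Rect

variable {x₀ x₁ y₀ y₁ : ℝ}

theorem bottom_mem_rectBoundary (hy : y₀ ≤ y₁) {x : ℝ} (hx : x ∈ Icc x₀ x₁) :
    (x + y₀ * Complex.I : ℂ) ∈ rectBoundary x₀ x₁ y₀ y₁ := by
  simp [rectBoundary, Complex.mem_reProdIm, hx.1, hx.2, hy]

theorem top_mem_rectBoundary (hy : y₀ ≤ y₁) {x : ℝ} (hx : x ∈ Icc x₀ x₁) :
    (x + y₁ * Complex.I : ℂ) ∈ rectBoundary x₀ x₁ y₀ y₁ := by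
  simp [rectBoundary, Complex.mem_reProdIm, hx.1, hx.2, hy]

theorem left_mem_rectBoundary (hx : x₀ ≤ x₁) {y : ℝ} (hy : y ∈ Icc y₀ y₁) :
    (x₀ + y * Complex.I : ℂ) ∈ rectBoundary x₀ x₁ y₀ y₁ := by
  simp [rectBoundary, Complex.mem_reProdIm, hy.1, hy.2, hx]

theorem right_mem_rectBoundary (hx : x₀ ≤ x₁) {y : ℝ} (hy : y ∈ Icc y₀ y₁) :
    (x₁ + y * Complex.I : ℂ) ∈ rectBoundary x₀ x₁ y₀ y₁ := by
  simp [rectBoundary, Complex.mem_reProdIm, hy.1, hy.2, hx]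

theorem rectIntegrable_of_continuousAt (hx : x₀ ≤ x₁) (hy : y₀ ≤ y₁) {g : ℂ → ℂ}
    (hg : ∀ u ∈ rectBoundary x₀ x₁ y₀ y₁, ContinuousAt g u) :
    RectIntegrable g x₀ x₁ y₀ y₁ := by
  constructor <;> refine ContinuousOn.intervalIntegrable fun t ht => ?_ <;>
    first
    | rw [uIcc_of_le hx] at ht
    | rw [uIcc_of_le hy] at ht
  · exact (ContinuousAt.comp (f := fun x : ℝ => (x + y₀ * Complex.I : ℂ))
      (hg _ (bottom_mem_rectBoundary hy ht)) (by fun_prop)).continuousWithinAt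
  · exact (ContinuousAt.comp (f := fun y : ℝ => (x₁ + y * Complex.I : ℂ))
      (hg _ (right_mem_rectBoundary hx ht)) (by fun_prop)).continuousWithinAt
  · exact (ContinuousAt.comp (f := fun x : ℝ => (x + y₁ * Complex.I : ℂ))
      (hg _ (top_mem_rectBoundary hy ht)) (by fun_prop)).continuousWithinAt
  · exact (ContinuousAt.comp (f := fun y : ℝ => (x₀ + y * Complex.I : ℂ))
      (hg _ (left_mem_rectBoundary hx ht)) (by fun_prop)).continuousWithinAt

theorem rectIntegral_congr (hx : x₀ ≤ x₁) (hy : y₀ ≤ y₁) {g k : ℂ → ℂ}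
    (h : ∀ u ∈ rectBoundary x₀ x₁ y₀ y₁, g u = k u) :
    rectIntegral g x₀ x₁ y₀ y₁ = rectIntegral k x₀ x₁ y₀ y₁ := by
  unfold rectIntegral
  congr 1
  · congr 1
    · congr 1
      · refine intervalIntegral.integral_congr fun t ht => ?_
        rw [uIcc_of_le hx] at ht
        exact h _ (bottom_mem_rectBoundary hy ht)
      · congr 1
        refine intervalIntegral.integral_congr fun t ht => ?_
        rw [uIcc_of_le hy] at ht
        exact h _ (right_mem_rectBoundary hx ht)
    · refine intervalIntegral.integral_congr fun t ht => ?_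
      rw [uIcc_of_le hx] at ht
      exact h _ (top_mem_rectBoundary hy ht)
  · congr 1
    refine intervalIntegral.integral_congr fun t ht => ?_
    rw [uIcc_of_le hy] at ht
    exact h _ (left_mem_rectBoundary hx ht)

theorem rectIntegral_sub {g k : ℂ → ℂ} (hg : RectIntegrable g x₀ x₁ y₀ y₁)
    (hk : RectIntegrable k x₀ x₁ y₀ y₁) :
    rectIntegral (fun u => g u - k u) x₀ x₁ y₀ y₁ =
      rectIntegral g x₀ x₁ y₀ y₁ - rectIntegral k x₀ x₁ y₀ y₁ := by
  unfold rectIntegral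
  rw [intervalIntegral.integral_sub hg.bottom hk.bottom,
    intervalIntegral.integral_sub hg.right hk.right,
    intervalIntegral.integral_sub hg.top hk.top,
    intervalIntegral.integral_sub hg.left hk.left]
  ring

theorem rectIntegral_const_mul (c : ℂ) (g : ℂ → ℂ) :
    rectIntegral (fun u => c * g u) x₀ x₁ y₀ y₁ = c * rectIntegral g x₀ x₁ y₀ y₁ := by
  unfold rectIntegral
  simp only [intervalIntegral.integral_const_mul]
  ring

theorem log_neg_of_im_pos {w : ℂ} (hw : 0 < w.im) :
    Complex.log (-w) = Complex.log w - Real.pi * Complex.I := by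
  simp only [Complex.log, norm_neg, Complex.arg_neg_eq_arg_sub_pi_of_im_pos hw]
  push_cast
  ring

theorem log_neg_of_im_neg {w : ℂ} (hw : w.im < 0) :
    Complex.log (-w) = Complex.log w + Real.pi * Complex.I := by
  simp only [Complex.log, norm_neg, Complex.arg_neg_eq_arg_add_pi_of_im_neg hw]
  push_cast
  ring

/-- Each side gets a branch of the logarithm that is smooth on it: `log (u - p)` on the bottom,
right and top, and `log (-(u - p))` on the left, where `u - p` crosses the cut. The mismatch is `πi`
at each of the two left corners. -/
theorem rectIntegral_inv_sub {p : ℂ} (hp : p ∈ Ioo x₀ x₁ ×ℂ Ioo y₀ y₁) :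
    rectIntegral (fun u => (u - p)⁻¹) x₀ x₁ y₀ y₁ = 2 * Real.pi * Complex.I := by
  obtain ⟨⟨hx0, hx1⟩, hy0, hy1⟩ := hp
  have hx : x₀ ≤ x₁ := by linarith
  have hy : y₀ ≤ y₁ := by linarith
  have hne : ∀ u ∈ rectBoundary x₀ x₁ y₀ y₁, u ≠ p := by
    rintro u ⟨-, h⟩ rfl
    rcases h with h | h | h | h <;> linarith
  have hint : RectIntegrable (fun u => (u - p)⁻¹) x₀ x₁ y₀ y₁ :=
    rectIntegrable_of_continuousAt hx hy fun u hu =>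
      ContinuousAt.inv₀ (by fun_prop) (sub_ne_zero.2 (hne u hu))
  have hB : ∫ x in x₀..x₁, ((x + y₀ * Complex.I : ℂ) - p)⁻¹ =
      Complex.log (x₁ + y₀ * Complex.I - p) - Complex.log (x₀ + y₀ * Complex.I - p) := by
    refine intervalIntegral.integral_eq_sub_of_hasDerivAt
      (f := fun x : ℝ => Complex.log (x + y₀ * Complex.I - p)) (fun t _ => ?_) hint.bottom
    have h1 : HasDerivAt (fun x : ℝ => (x + y₀ * Complex.I - p : ℂ)) 1 t :=
      (((hasDerivAt_id t).ofReal_comp).add_const _).sub_const _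
    simpa using h1.clog_real (Or.inr (by simp; linarith))
  have hT : ∫ x in x₀..x₁, ((x + y₁ * Complex.I : ℂ) - p)⁻¹ =
      Complex.log (x₁ + y₁ * Complex.I - p) - Complex.log (x₀ + y₁ * Complex.I - p) := by
    refine intervalIntegral.integral_eq_sub_of_hasDerivAt
      (f := fun x : ℝ => Complex.log (x + y₁ * Complex.I - p)) (fun t _ => ?_) hint.top
    have h1 : HasDerivAt (fun x : ℝ => (x + y₁ * Complex.I - p : ℂ)) 1 t :=
      (((hasDerivAt_id t).ofReal_comp).add_const _).sub_const _
    simpa using h1.clog_real (Or.inr (by simp; linarith))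
  have hR : Complex.I * ∫ y in y₀..y₁, ((x₁ + y * Complex.I : ℂ) - p)⁻¹ =
      Complex.log (x₁ + y₁ * Complex.I - p) - Complex.log (x₁ + y₀ * Complex.I - p) := by
    rw [← intervalIntegral.integral_const_mul]
    refine intervalIntegral.integral_eq_sub_of_hasDerivAt
      (f := fun y : ℝ => Complex.log (x₁ + y * Complex.I - p)) (fun t _ => ?_)
      (hint.right.const_mul _)
    have h1 : HasDerivAt (fun y : ℝ => (x₁ + y * Complex.I - p : ℂ)) (1 * Complex.I) t :=
      ((((hasDerivAt_id t).ofReal_comp).mul_const Complex.I).const_add _).sub_const _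
    simpa [div_eq_mul_inv] using h1.clog_real (Or.inl (by simp; linarith))
  have hL : Complex.I * ∫ y in y₀..y₁, ((x₀ + y * Complex.I : ℂ) - p)⁻¹ =
      Complex.log (-(x₀ + y₁ * Complex.I - p)) - Complex.log (-(x₀ + y₀ * Complex.I - p)) := by
    rw [← intervalIntegral.integral_const_mul]
    refine intervalIntegral.integral_eq_sub_of_hasDerivAt
      (f := fun y : ℝ => Complex.log (-(x₀ + y * Complex.I - p))) (fun t _ => ?_)
      (hint.left.const_mul _)
    have h1 : HasDerivAt (fun y : ℝ => -(x₀ + y * Complex.I - p : ℂ)) (-(1 * Complex.I)) t :=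
      (((((hasDerivAt_id t).ofReal_comp).mul_const Complex.I).const_add _).sub_const _).neg
    have h2 := h1.clog_real (Or.inl (by simp; linarith))
    rw [neg_div_neg_eq] at h2
    simpa [div_eq_mul_inv] using h2
  unfold rectIntegral
  rw [hB, hT, hR, hL, log_neg_of_im_pos (by simp; linarith),
    log_neg_of_im_neg (by simp; linarith)]
  ring

/-- Induction on the set of poles: subtracting `c p / (u - p)` makes the singularity at `p`
removable, and the empty case is Cauchy's theorem. -/
theorem rectIntegral_eq_sum_residues (hx : x₀ ≤ x₁) (hy : y₀ ≤ y₁) (S : Finset ℂ) (c : ℂ → ℂ) :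
    ∀ g : ℂ → ℂ, (∀ p ∈ S, p ∈ Ioo x₀ x₁ ×ℂ Ioo y₀ y₁) →
      (∀ u ∈ Icc x₀ x₁ ×ℂ Icc y₀ y₁, u ∉ S → DifferentiableAt ℂ g u) →
      (∀ p ∈ S, Tendsto (fun u => (u - p) * g u) (𝓝[≠] p) (𝓝 (c p))) →
      rectIntegral g x₀ x₁ y₀ y₁ = 2 * Real.pi * Complex.I * ∑ p ∈ S, c p := by
  induction S using Finset.induction_on with
  | empty =>
    intro g _ hd _
    have h := Complex.integral_boundary_rect_eq_zero_of_differentiableOn g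
      (x₀ + y₀ * Complex.I) (x₁ + y₁ * Complex.I) (by
        intro u hu
        simp only [Complex.add_re, Complex.ofReal_re, Complex.mul_re, Complex.I_re, mul_zero,
          Complex.ofReal_im, Complex.I_im, mul_one, sub_self, add_zero, Complex.add_im,
          Complex.mul_im, zero_add, uIcc_of_le hx, uIcc_of_le hy] at hu
        exact (hd u hu (by simp)).differentiableWithinAt)
    simp only [Complex.add_re, Complex.ofReal_re, Complex.mul_re, Complex.I_re, mul_zero,
      Complex.ofReal_im, Complex.I_im, mul_one, sub_self, add_zero, Complex.add_im,
      Complex.mul_im, zero_add, smul_eq_mul] at h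
    simp only [Finset.sum_empty, mul_zero]
    rw [← h]
    unfold rectIntegral
    ring
  | insert p S hpS ih =>
    intro g hS hd hc
    have hp := hS p (Finset.mem_insert_self p S)
    have hbne : ∀ u ∈ rectBoundary x₀ x₁ y₀ y₁, u ∉ insert p S := by
      intro u hu hmem
      obtain ⟨⟨h1, h2⟩, h3, h4⟩ := hS u hmem
      obtain ⟨-, h⟩ := hu
      rcases h with h | h | h | h <;> linarith
    set G : ℂ → ℂ := fun u => g u - c p * (u - p)⁻¹ with hG
    set K : ℂ → ℂ := Function.update G p (limUnder (𝓝[≠] p) G) with hK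
    have hGd : ∀ u ∈ Icc x₀ x₁ ×ℂ Icc y₀ y₁, u ∉ insert p S → DifferentiableAt ℂ G u := by
      intro u hu hne
      have hup : u - p ≠ 0 := sub_ne_zero.2 fun h => hne (h ▸ Finset.mem_insert_self p S)
      have h1 := hd u hu hne
      fun_prop (disch := assumption)
    have hKG : ∀ u, u ≠ p → K =ᶠ[𝓝 u] G := fun u hu => by
      filter_upwards [isOpen_ne.mem_nhds hu] with w hw
      exact Function.update_of_ne hw _ _
    have hKp : DifferentiableAt ℂ K p := by
      have hopen : IsOpen ((Ioo x₀ x₁ ×ℂ Ioo y₀ y₁) \ (S : Set ℂ)) :=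
        (isOpen_Ioo.reProdIm isOpen_Ioo).sdiff S.finite_toSet.isClosed
      have hmem : (Ioo x₀ x₁ ×ℂ Ioo y₀ y₁) \ (S : Set ℂ) ∈ 𝓝 p :=
        hopen.mem_nhds ⟨hp, by simpa using hpS⟩
      refine (Complex.differentiableOn_update_limUnder_of_isLittleO hmem ?_ ?_).differentiableAt
        hmem
      · rintro u ⟨⟨hu, huS⟩, hup⟩
        refine (hGd u ⟨Ioo_subset_Icc_self hu.1, Ioo_subset_Icc_self hu.2⟩ ?_).differentiableWithinAt
        simp only [Finset.mem_insert, not_or]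
        exact ⟨hup, huS⟩
      -- The removability criterion amounts to `(u - p) (G u - G p) → 0`. The value `G p` has no
      -- meaning, but it is a constant and is killed by the factor `u - p`.
      · rw [Asymptotics.isLittleO_iff_tendsto']
        · have h1 : Tendsto (fun u => (u - p) * g u - c p - (u - p) * G p) (𝓝[≠] p)
              (𝓝 (c p - c p - (p - p) * G p)) := by
            refine ((hc p (Finset.mem_insert_self p S)).sub_const _).sub ?_
            exact Tendsto.mono_left (Continuous.tendsto (by fun_prop) p) nhdsWithin_le_nhds
          simp only [sub_self, zero_mul] at h1
          refine h1.congr' ?_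
          filter_upwards [self_mem_nhdsWithin] with u hu
          have hup : u - p ≠ 0 := sub_ne_zero.2 hu
          simp only [hG]
          field_simp
        · filter_upwards [self_mem_nhdsWithin] with u hu h
          exact absurd h (inv_ne_zero (sub_ne_zero.2 hu))
    have h1 := ih K (fun q hq => hS q (Finset.mem_insert_of_mem hq)) (by
        intro u hu huS
        by_cases hup : u = p
        · exact hup ▸ hKp
        · exact (hGd u hu (by simp [hup, huS])).congr_of_eventuallyEq (hKG u hup)) (by
        intro q hq
        have hqp : q ≠ p := fun h => hpS (h ▸ hq)
        have h2 : Tendsto (fun u => (u - q) * g u - (u - q) * (c p * (u - p)⁻¹)) (𝓝[≠] q)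
            (𝓝 (c q - (q - q) * (c p * (q - p)⁻¹))) := by
          refine (hc q (Finset.mem_insert_of_mem hq)).sub ?_
          refine Tendsto.mono_left (ContinuousAt.tendsto (f := fun u =>
            (u - q) * (c p * (u - p)⁻¹)) ?_) nhdsWithin_le_nhds
          have := sub_ne_zero.2 hqp
          fun_prop (disch := assumption)
        simp only [sub_self, zero_mul, sub_zero] at h2
        refine h2.congr' ?_
        filter_upwards [nhdsWithin_le_nhds (hKG q hqp)] with u hu
        rw [hu, hG]
        ring)
    have h3 : rectIntegral K x₀ x₁ y₀ y₁ = rectIntegral G x₀ x₁ y₀ y₁ :=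
      rectIntegral_congr hx hy fun u hu =>
        (hKG u fun h => hbne u hu (h ▸ Finset.mem_insert_self p S)).eq_of_nhds
    have h4 : rectIntegral G x₀ x₁ y₀ y₁ = rectIntegral g x₀ x₁ y₀ y₁ -
        c p * (2 * Real.pi * Complex.I) := by
      rw [hG, rectIntegral_sub, rectIntegral_const_mul, rectIntegral_inv_sub hp]
      · exact rectIntegrable_of_continuousAt hx hy fun u hu =>
          (hd u hu.1 (hbne u hu)).continuousAt
      · refine rectIntegrable_of_continuousAt hx hy fun u hu => ?_
        have hup : u - p ≠ 0 :=
          sub_ne_zero.2 fun h => hbne u hu (h ▸ Finset.mem_insert_self p S)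
        fun_prop (disch := assumption)
    rw [Finset.sum_insert hpS, mul_add, ← h1, h3, h4]
    ring

end Rect

/-! ### The principal square root -/

theorem csqrt_sq (u : ℂ) : Complex.sqrt u ^ 2 = u := by
  rw [Complex.sqrt, ← Complex.cpow_nat_mul]
  simp

theorem csqrt_ne_zero {u : ℂ} (hu : u ≠ 0) : Complex.sqrt u ≠ 0 := by
  intro h
  have := csqrt_sq u
  rw [h] at this
  exact hu (by simpa using this.symm)

theorem csqrt_re_pos {u : ℂ} (hu : u ∈ Complex.slitPlane) : 0 < (Complex.sqrt u).re := by
  have h0 := Complex.slitPlane_ne_zero hu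
  rw [sqrt_eq_exp h0, Complex.exp_re]
  have h1 := Complex.neg_pi_lt_arg u
  have h2 := lt_of_le_of_ne (Complex.arg_le_pi u) (Complex.mem_slitPlane_iff_arg.1 hu).1
  refine mul_pos (Real.exp_pos _) (Real.cos_pos_of_mem_Ioo ?_)
  have h3 : (Complex.log u / 2).im = u.arg / 2 := by
    rw [show (2 : ℂ) = ((2 : ℝ) : ℂ) by norm_num, Complex.div_ofReal_im, Complex.log_im]
  rw [h3]
  constructor <;> linarith

theorem mem_slitPlane_sq {w : ℂ} (hw : 0 < w.re) : w ^ 2 ∈ Complex.slitPlane := by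
  rw [Complex.mem_slitPlane_iff]
  by_cases h : w.im = 0
  · left
    rw [sq, Complex.mul_re, h]
    nlinarith
  · right
    rw [sq, Complex.mul_im]
    intro h1
    have : 2 * w.re * w.im = 0 := by linarith
    simp [hw.ne', h] at this

/-- Of the two square roots `±w`, only one lies in the right half plane. This allows poles of `f` to
be written as `w²` with `w` explicit. -/
theorem csqrt_of_sq {w : ℂ} (hw : 0 < w.re) : Complex.sqrt (w ^ 2) = w := by
  have h1 := csqrt_re_pos (mem_slitPlane_sq hw)
  rcases sq_eq_sq_iff_eq_or_eq_neg.1 (csqrt_sq (w ^ 2)) with h | h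
  · exact h
  · rw [h, Complex.neg_re] at h1
    linarith

theorem csqrt_ofReal {x : ℝ} (hx : 0 ≤ x) : Complex.sqrt x = (Real.sqrt x : ℂ) := by
  rw [Complex.sqrt_of_nonneg (by exact_mod_cast hx)]
  simp

theorem hasDerivAt_csqrt {u : ℂ} (hu : u ∈ Complex.slitPlane) :
    HasDerivAt Complex.sqrt (1 / (2 * Complex.sqrt u)) u := by
  refine (Complex.hasDerivAt_sqrt hu).congr_deriv ?_
  rw [show (-1 / 2 : ℂ) = -(2⁻¹) by norm_num, Complex.cpow_neg, Complex.sqrt]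
  field_simp

/-- The limit defining the residue of a quotient at a simple zero of its denominator. -/
theorem tendsto_sub_mul_div {n d : ℂ → ℂ} {p d' : ℂ} (hn : ContinuousAt n p)
    (hd : HasDerivAt d d' p) (hp : d p = 0) (hd' : d' ≠ 0) :
    Tendsto (fun u => (u - p) * (n u / d u)) (𝓝[≠] p) (𝓝 (n p / d')) := by
  have h1 := hasDerivAt_iff_tendsto_slope.1 hd
  refine ((hn.tendsto.mono_left nhdsWithin_le_nhds).div h1 hd').congr' ?_
  filter_upwards [self_mem_nhdsWithin] with u hu
  have hup : u - p ≠ 0 := sub_ne_zero.2 hu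
  rw [Pi.div_apply, slope_def_field, hp, sub_zero, div_div_eq_mul_div]
  ring

/-! ### Regularity and residues of `f` and `m` -/

theorem differentiableAt_integrand {T : ℝ} {u z : ℂ} (hu : u ∈ Complex.slitPlane)
    (hz : Complex.exp (2 * (Complex.sqrt u - T)) + z ≠ 0) :
    DifferentiableAt ℂ (fun u => integrand T u z) u := by
  have h0 := csqrt_ne_zero (Complex.slitPlane_ne_zero hu)
  unfold integrand
  fun_prop (disch := assumption)

/-- At a pole the exponential equals `-z`, so the denominator has derivative `-z / √p`; this cancels
the prefactor `z / √p` of the numerator. -/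
theorem tendsto_sub_mul_integrand {T : ℝ} {p z : ℂ} (hp : p ∈ Complex.slitPlane) (hz0 : z ≠ 0)
    (hz : Complex.exp (2 * (Complex.sqrt p - T)) + z = 0) :
    Tendsto (fun u => (u - p) * integrand T u z) (𝓝[≠] p)
      (𝓝 (-Complex.exp (Complex.sqrt p - T) / Real.pi)) := by
  have h0 := csqrt_ne_zero (Complex.slitPlane_ne_zero hp)
  have hd : HasDerivAt (fun u => Complex.exp (2 * (Complex.sqrt u - T)) + z)
      (-z / Complex.sqrt p) p := by
    refine ((((hasDerivAt_csqrt hp).sub_const (T : ℂ)).const_mul 2).cexp.add_const z).congr_deriv ?_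
    rw [eq_neg_of_add_eq_zero_left hz]
    field_simp
  have hn : ContinuousAt (fun u => z / (Real.pi : ℂ) * (1 / Complex.sqrt u) *
      Complex.exp (Complex.sqrt u - T)) p := by
    have := Complex.differentiableAt_sqrt hp |>.continuousAt
    fun_prop (disch := assumption)
  have := tendsto_sub_mul_div hn hd hz (div_ne_zero (neg_ne_zero.2 hz0) h0)
  convert this using 2
  · unfold integrand
    ring
  · have hpi : (Real.pi : ℂ) ≠ 0 := by exact_mod_cast Real.pi_ne_zero
    field_simp

theorem differentiableAt_mFun {h : ℝ} {u : ℂ} (hu : Complex.sin (Real.pi * u / h) ≠ 0) :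
    DifferentiableAt ℂ (mFun h) u := by
  unfold mFun Complex.cot
  fun_prop (disch := assumption)

/-- The limit is `h / (2πi)`, the residue that makes a contour integral of `f m` reproduce the
trapezoidal sum. -/
theorem tendsto_sub_mul_mFun {h : ℝ} (hh : h ≠ 0) (j : ℕ) :
    Tendsto (fun u => (u - (j * h : ℝ)) * mFun h u) (𝓝[≠] ((j * h : ℝ) : ℂ))
      (𝓝 (-(Complex.I / 2) * (h / Real.pi))) := by
  have hpi : (Real.pi : ℂ) ≠ 0 := by exact_mod_cast Real.pi_ne_zero
  have hh' : (h : ℂ) ≠ 0 := by exact_mod_cast hh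
  have harg : (Real.pi : ℂ) * ((j * h : ℝ) : ℂ) / h = (j : ℂ) * Real.pi := by
    push_cast
    field_simp
  have hs : Complex.sin ((Real.pi : ℂ) * ((j * h : ℝ) : ℂ) / h) = 0 := by
    rw [harg, Complex.sin_nat_mul_pi]
  have hc : Complex.cos ((Real.pi : ℂ) * ((j * h : ℝ) : ℂ) / h) ≠ 0 := by
    intro h0
    have := Complex.sin_sq_add_cos_sq ((Real.pi : ℂ) * ((j * h : ℝ) : ℂ) / h)
    rw [hs, h0] at this
    norm_num at this
  have hd : HasDerivAt (fun u : ℂ => Complex.sin (Real.pi * u / h))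
      (Complex.cos ((Real.pi : ℂ) * ((j * h : ℝ) : ℂ) / h) * (Real.pi * 1 / h))
      ((j * h : ℝ) : ℂ) :=
    (((hasDerivAt_id _).const_mul _).div_const _).csin
  have hn : ContinuousAt (fun u : ℂ => -(Complex.I / 2) * Complex.cos (Real.pi * u / h))
      ((j * h : ℝ) : ℂ) := by fun_prop
  have := tendsto_sub_mul_div hn hd hs (by
    exact mul_ne_zero hc (div_ne_zero (by simp) hh'))
  convert this using 2
  · unfold mFun Complex.cot
    ring
  · field_simp

theorem sin_pi_mul_div_eq_zero {h : ℝ} (hh : h ≠ 0) {u : ℂ}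
    (hu : Complex.sin (Real.pi * u / h) = 0) : ∃ k : ℤ, u = ((k * h : ℝ) : ℂ) := by
  obtain ⟨k, hk⟩ := Complex.sin_eq_zero_iff.1 hu
  refine ⟨k, ?_⟩
  have hpi : (Real.pi : ℂ) ≠ 0 := by exact_mod_cast Real.pi_ne_zero
  have hh' : (h : ℂ) ≠ 0 := by exact_mod_cast hh
  push_cast
  field_simp at hk
  rw [hk, mul_comm]

theorem sin_pi_mul_div_ne_zero_of_im {h : ℝ} (hh : h ≠ 0) {u : ℂ} (hu : u.im ≠ 0) :
    Complex.sin (Real.pi * u / h) ≠ 0 := fun h0 => by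
  obtain ⟨k, hk⟩ := sin_pi_mul_div_eq_zero hh h0
  exact hu (by rw [hk, Complex.ofReal_im])

/-! ### Exponential decay of `δ` away from the real axis -/

/-- `-1/2 + (i/2) cot v = q / (1 - q)` with `q = e^{2iv}`. -/
theorem cot_add_eq_exp_div {v : ℂ} (hq : Complex.exp (2 * Complex.I * v) ≠ 1) :
    -(1 / 2) + Complex.I / 2 * Complex.cot v =
      Complex.exp (2 * Complex.I * v) / (1 - Complex.exp (2 * Complex.I * v)) := by
  rw [Complex.cot_eq_exp_ratio]
  have h1 : 1 - Complex.exp (2 * Complex.I * v) ≠ 0 := sub_ne_zero.2 (Ne.symm hq)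
  set q := Complex.exp (2 * Complex.I * v)
  have hI := Complex.I_sq
  field_simp
  ring

theorem norm_exp_div_le {q : ℂ} {t : ℝ} (hq : ‖q‖ ≤ t) (ht : t ≤ 1 / 2) :
    ‖q / (1 - q)‖ ≤ 2 * t := by
  rw [norm_div]
  have h1 : 1 / 2 ≤ ‖1 - q‖ := by
    have := norm_sub_norm_le (1 : ℂ) q
    rw [norm_one] at this
    linarith
  rw [div_le_iff₀ (by linarith)]
  have := norm_nonneg q
  nlinarith

/-- Above the axis `δ = q / (1 - q)` with `q = e^{2πiu/h}`, and `|q| ≤ e^{-s} ≤ 1/2`. Below the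
axis, oddness of the cotangent reduces to the same estimate at `-u`. -/
theorem norm_deltaFun_le {h : ℝ} (hh : 0 < h) {u : ℂ} {s : ℝ} (hu : u.im ≠ 0)
    (hs : s * h ≤ 2 * Real.pi * |u.im|) (hs1 : 1 ≤ s) :
    ‖deltaFun h u‖ ≤ 2 * Real.exp (-s) := by
  have hhalf : Real.exp (-s) ≤ 1 / 2 := by
    have h1 : Real.exp (-s) ≤ Real.exp (-1) := Real.exp_le_exp.2 (by linarith)
    have := Real.exp_neg_one_lt_half
    linarith
  have key : ∀ v : ℂ, s ≤ 2 * v.im →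
      ‖-(1 / 2) + Complex.I / 2 * Complex.cot v‖ ≤ 2 * Real.exp (-s) := by
    intro v hv
    have hn : ‖Complex.exp (2 * Complex.I * v)‖ ≤ Real.exp (-s) := by
      rw [Complex.norm_exp, Real.exp_le_exp]
      simp
      linarith
    rw [cot_add_eq_exp_div]
    · exact norm_exp_div_le hn hhalf
    · intro h1
      rw [h1, norm_one] at hn
      linarith
  have him : ((Real.pi : ℂ) * u / h).im = Real.pi * u.im / h := by
    rw [Complex.div_ofReal_im, Complex.im_ofReal_mul]
  unfold deltaFun muFun mFun
  rcases lt_or_gt_of_ne hu with hneg | hpos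
  · rw [if_neg (not_le.2 hneg)]
    have h2 := key (-((Real.pi : ℂ) * u / h)) (by
      rw [Complex.neg_im, him]
      rw [abs_of_neg hneg] at hs
      rw [show 2 * -(Real.pi * u.im / h) = (2 * Real.pi * -u.im) / h by ring, le_div_iff₀ hh]
      exact hs)
    rw [show Complex.cot (-((Real.pi : ℂ) * u / h)) = -Complex.cot ((Real.pi : ℂ) * u / h) by
      simp [Complex.cot, div_neg]] at h2
    refine le_of_eq_of_le ?_ h2
    rw [← norm_neg (-(1 / 2) + _)]
    congr 1
    ring
  · rw [if_pos hpos.le]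
    have h2 := key ((Real.pi : ℂ) * u / h) (by
      rw [him]
      rw [abs_of_pos hpos] at hs
      rw [show 2 * (Real.pi * u.im / h) = (2 * Real.pi * u.im) / h by ring, le_div_iff₀ hh]
      exact hs)
    convert h2 using 2
    ring

/-- A point `t` of the real line and a point of argument `θ` do not cancel. -/
theorem cos_mul_le_norm_add {r θ t : ℝ} :
    Real.cos (θ / 2) * (t + r) ≤ ‖(t : ℂ) + r * Complex.exp (θ * Complex.I)‖ := by
  have h1 : ‖Complex.exp (-((θ / 2 : ℝ) : ℂ) * Complex.I)‖ = 1 := by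
    rw [← Complex.ofReal_neg, Complex.norm_exp_ofReal_mul_I]
  -- Rotation by `-θ/2` places the two summands at the opposite angles `∓θ/2`, so their real parts
  -- carry the same factor `cos (θ/2)`.
  have h2 : Complex.exp (-((θ / 2 : ℝ) : ℂ) * Complex.I) *
      ((t : ℂ) + r * Complex.exp (θ * Complex.I)) =
      t * Complex.exp (((-(θ / 2) : ℝ) : ℂ) * Complex.I) +
        r * Complex.exp (((θ / 2 : ℝ) : ℂ) * Complex.I) := by
    rw [show (θ : ℂ) * Complex.I = ((θ / 2 : ℝ) : ℂ) * Complex.I + ((θ / 2 : ℝ) : ℂ) * Complex.I by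
      push_cast; ring, Complex.exp_add]
    have : Complex.exp (-((θ / 2 : ℝ) : ℂ) * Complex.I) *
        Complex.exp (((θ / 2 : ℝ) : ℂ) * Complex.I) = 1 := by
      rw [← Complex.exp_add]
      simp
    rw [Complex.ofReal_neg]
    linear_combination (r * Complex.exp (((θ / 2 : ℝ) : ℂ) * Complex.I)) * this
  calc Real.cos (θ / 2) * (t + r)
      = (Complex.exp (-((θ / 2 : ℝ) : ℂ) * Complex.I) *
          ((t : ℂ) + r * Complex.exp (θ * Complex.I))).re := by
        rw [h2, Complex.add_re, Complex.re_ofReal_mul, Complex.re_ofReal_mul,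
          Complex.exp_ofReal_mul_I_re, Complex.exp_ofReal_mul_I_re, Real.cos_neg]
        ring
    _ ≤ _ := Complex.re_le_norm _
    _ = _ := by rw [norm_mul, h1, one_mul]

/-! ### The contour identity for the quadrature error -/

theorem integral_mul_sign_step {k : ℝ → ℂ} {a : ℝ} (ha : 0 ≤ a)
    (hk : IntervalIntegrable k MeasureTheory.volume (-a) a) :
    IntervalIntegrable (fun y => k y * if 0 ≤ y then (-(1 / 2) : ℂ) else 1 / 2)
        MeasureTheory.volume (-a) a ∧
      ∫ y in (-a)..a, (k y * if 0 ≤ y then (-(1 / 2) : ℂ) else 1 / 2) =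
        (∫ y in (-a)..0, k y) * (1 / 2) - (∫ y in (0 : ℝ)..a, k y) * (1 / 2) := by
  have h1 : IntervalIntegrable k MeasureTheory.volume (-a) 0 :=
    hk.mono_set (by
      rw [uIcc_of_le (by linarith), uIcc_of_le (by linarith)]
      exact Icc_subset_Icc_right ha)
  have h2 : IntervalIntegrable k MeasureTheory.volume 0 a :=
    hk.mono_set (by
      rw [uIcc_of_le ha, uIcc_of_le (by linarith)]
      exact Icc_subset_Icc_left (by linarith))
  -- Agreement on open intervals suffices, so the value of the step at `0` is immaterial.
  have e1 : ∀ y ∈ uIoo (-a) 0, k y * (1 / 2) = k y * if 0 ≤ y then (-(1 / 2) : ℂ) else 1 / 2 := by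
    intro y hy
    rw [uIoo_of_le (by linarith)] at hy
    rw [if_neg (not_le.2 hy.2)]
  have e2 : ∀ y ∈ uIoo 0 a,
      k y * (-(1 / 2)) = k y * if 0 ≤ y then (-(1 / 2) : ℂ) else 1 / 2 := by
    intro y hy
    rw [uIoo_of_le ha] at hy
    rw [if_pos hy.1.le]
  have i1 := (h1.mul_const (1 / 2)).congr_uIoo e1
  have i2 := (h2.mul_const (-(1 / 2))).congr_uIoo e2
  refine ⟨i1.trans i2, ?_⟩
  rw [← intervalIntegral.integral_add_adjacent_intervals i1 i2,
    ← intervalIntegral.integral_congr_uIoo e1, ← intervalIntegral.integral_congr_uIoo e2,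
    intervalIntegral.integral_mul_const, intervalIntegral.integral_mul_const]
  ring

/-- The integral of `g μ` over a rectangle symmetric about the real axis. -/
theorem rectIntegral_mul_muFun {g : ℂ → ℂ} {x₀ x₁ a : ℝ} (ha : 0 < a)
    (hg : RectIntegrable g x₀ x₁ (-a) a) :
    RectIntegrable (fun u => g u * muFun u) x₀ x₁ (-a) a ∧
      rectIntegral (fun u => g u * muFun u) x₀ x₁ (-a) a =
        (∫ x in x₀..x₁, g x) - rectIntegral g x₀ x₁ 0 a / 2 + rectIntegral g x₀ x₁ (-a) 0 / 2 := by
  have hr := integral_mul_sign_step ha.le hg.right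
  have hl := integral_mul_sign_step ha.le hg.left
  have hb : ∀ x : ℝ, muFun (x + (-a : ℝ) * Complex.I) = 1 / 2 := fun x => by
    simp [muFun, ha]
  have ht : ∀ x : ℝ, muFun (x + a * Complex.I) = -(1 / 2) := fun x => by
    simp [muFun, ha.le]
  have hs : ∀ x y : ℝ, muFun (x + y * Complex.I) = if 0 ≤ y then (-(1 / 2) : ℂ) else 1 / 2 :=
    fun x y => by simp [muFun]
  refine ⟨⟨?_, ?_, ?_, ?_⟩, ?_⟩
  · simp only [hb]
    exact hg.bottom.mul_const _
  · simp only [hs]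
    exact hr.1
  · simp only [ht]
    exact hg.top.mul_const _
  · simp only [hs]
    exact hl.1
  -- With the real segment added, each half of the contour closes up to a rectangle. The segment
  -- enters with weight `1/2` from above and `1/2` from below, hence once in total.
  · unfold rectIntegral
    simp only [hb, ht]
    simp only [hs]
    rw [hr.2, hl.2, intervalIntegral.integral_mul_const, intervalIntegral.integral_mul_const]
    simp only [Complex.ofReal_zero, zero_mul, add_zero]
    ring

section Contour

variable {h T x₀ x₁ a : ℝ} {N : ℕ} {z wp wm : ℂ}

theorem mem_slitPlane_of_mem_rect {y₀ y₁ : ℝ} (hx₀ : 0 < x₀) {u : ℂ}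
    (hu : u ∈ Icc x₀ x₁ ×ℂ Icc y₀ y₁) : u ∈ Complex.slitPlane :=
  Or.inl (hx₀.trans_le hu.1.1)

/-- The residue theorem for `f` on a rectangle that contains a single pole. -/
theorem rectIntegral_integrand {y₀ y₁ : ℝ} (hx₀ : 0 < x₀) (hz : z ≠ 0) {w : ℂ} (hw : 0 < w.re)
    (hmem : w ^ 2 ∈ Ioo x₀ x₁ ×ℂ Ioo y₀ y₁) (hw0 : Complex.exp (2 * (w - T)) + z = 0)
    (huniq : ∀ u ∈ Icc x₀ x₁ ×ℂ Icc y₀ y₁,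
      Complex.exp (2 * (Complex.sqrt u - T)) + z = 0 → u = w ^ 2) :
    rectIntegral (fun u => integrand T u z) x₀ x₁ y₀ y₁ =
      -(2 * Complex.I * Complex.exp (w - T)) := by
  have hpi : (Real.pi : ℂ) ≠ 0 := by exact_mod_cast Real.pi_ne_zero
  rw [rectIntegral_eq_sum_residues (hmem.1.1.trans hmem.1.2).le (hmem.2.1.trans hmem.2.2).le
    {w ^ 2} (fun _ => -Complex.exp (w - T) / Real.pi)]
  · rw [Finset.sum_singleton]
    field_simp
  · simpa using hmem
  · intro u hu hne
    exact differentiableAt_integrand (mem_slitPlane_of_mem_rect hx₀ hu)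
      fun h0 => hne (by simpa using huniq u hu h0)
  · intro p hp
    rw [Finset.mem_singleton] at hp
    subst hp
    have := tendsto_sub_mul_integrand (T := T) (z := z) (mem_slitPlane_sq hw) hz
      (by rwa [csqrt_of_sq hw])
    rwa [csqrt_of_sq hw] at this

/-- The contour integral of `f δ` measures the quadrature error of the trapezoidal rule, up to the
contributions of the two poles of `f`. -/
theorem rectIntegral_integrand_mul_deltaFun (hh : 0 < h) (hx₀ : 0 < x₀) (hx₀h : x₀ < h)
    (hx₁ : x₁ = N * h + x₀) (hz : z ≠ 0)
    (hwp : 0 < wp.re) (hmp : wp ^ 2 ∈ Ioo x₀ x₁ ×ℂ Ioo 0 a)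
    (hzp : Complex.exp (2 * (wp - T)) + z = 0)
    (hwm : 0 < wm.re) (hmm : wm ^ 2 ∈ Ioo x₀ x₁ ×ℂ Ioo (-a) 0)
    (hzm : Complex.exp (2 * (wm - T)) + z = 0)
    (huniq : ∀ u ∈ Icc x₀ x₁ ×ℂ Icc (-a) a,
      Complex.exp (2 * (Complex.sqrt u - T)) + z = 0 → u = wp ^ 2 ∨ u = wm ^ 2) :
    rectIntegral (fun u => integrand T u z * deltaFun h u) x₀ x₁ (-a) a =
      (∫ x in x₀..x₁, integrand T x z)
        - h * ∑ j ∈ Finset.Icc 1 N, integrand T ((j * h : ℝ) : ℂ) z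
        - 2 * Complex.I * Complex.exp (wp - T) * deltaFun h (wp ^ 2)
        - 2 * Complex.I * Complex.exp (wm - T) * deltaFun h (wm ^ 2) := by
  have hpi : (Real.pi : ℂ) ≠ 0 := by exact_mod_cast Real.pi_ne_zero
  have hx : x₀ ≤ x₁ := (hmp.1.1.trans hmp.1.2).le
  have ha : 0 < a := hmp.2.1.trans hmp.2.2
  have hA : rectIntegral (fun u => integrand T u z) x₀ x₁ 0 a =
      -(2 * Complex.I * Complex.exp (wp - T)) := by
    refine rectIntegral_integrand hx₀ hz hwp hmp hzp fun u hu h0 => ?_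
    rcases huniq u ⟨hu.1, by linarith [hu.2.1], hu.2.2⟩ h0 with rfl | rfl
    · rfl
    · exact absurd hmm.2.2 (not_lt.2 hu.2.1)
  have hB : rectIntegral (fun u => integrand T u z) x₀ x₁ (-a) 0 =
      -(2 * Complex.I * Complex.exp (wm - T)) := by
    refine rectIntegral_integrand hx₀ hz hwm hmm hzm fun u hu h0 => ?_
    rcases huniq u ⟨hu.1, hu.2.1, by linarith [hu.2.2]⟩ h0 with rfl | rfl
    · exact absurd hmp.2.1 (not_lt.2 hu.2.2)
    · rfl
  have hmp' : wp ^ 2 ∈ Ioo x₀ x₁ ×ℂ Ioo (-a) a := ⟨hmp.1, by linarith [hmp.2.1], hmp.2.2⟩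
  have hmm' : wm ^ 2 ∈ Ioo x₀ x₁ ×ℂ Ioo (-a) a := ⟨hmm.1, hmm.2.1, by linarith [hmm.2.2]⟩
  -- Since `0 < x₀ < h` and `x₁ = N h + x₀`, the multiples of `h` in `[x₀, x₁]` are exactly those
  -- with `1 ≤ j ≤ N`.
  have hnode : ∀ j ∈ Finset.Icc 1 N, ((j * h : ℝ) : ℂ) ∈ Ioo x₀ x₁ ×ℂ Ioo (-a) a := by
    intro j hj
    rw [Finset.mem_Icc] at hj
    have h1 : (1 : ℝ) ≤ j := by exact_mod_cast hj.1
    have h2 : (j : ℝ) ≤ N := by exact_mod_cast hj.2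
    refine ⟨⟨?_, ?_⟩, ?_, ?_⟩
    · rw [Complex.ofReal_re]; nlinarith
    · rw [Complex.ofReal_re]; nlinarith
    · rw [Complex.ofReal_im]; linarith
    · rw [Complex.ofReal_im]; linarith
  have hbd : ∀ u ∈ rectBoundary x₀ x₁ (-a) a, u ∉ Ioo x₀ x₁ ×ℂ Ioo (-a) a := by
    rintro u ⟨-, hb⟩ ⟨⟨h1, h2⟩, h3, h4⟩
    rcases hb with hb | hb | hb | hb <;> linarith
  have hfd : ∀ u ∈ Icc x₀ x₁ ×ℂ Icc (-a) a, u ≠ wp ^ 2 → u ≠ wm ^ 2 →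
      DifferentiableAt ℂ (fun u => integrand T u z) u := fun u hu h1 h2 =>
    differentiableAt_integrand (mem_slitPlane_of_mem_rect hx₀ hu)
      fun h0 => (huniq u hu h0).elim h1 h2
  have hmd : ∀ u ∈ Icc x₀ x₁ ×ℂ Icc (-a) a, (∀ j ∈ Finset.Icc 1 N, u ≠ ((j * h : ℝ) : ℂ)) →
      DifferentiableAt ℂ (mFun h) u := by
    refine fun u hu h1 => differentiableAt_mFun fun h0 => ?_
    obtain ⟨k, rfl⟩ := sin_pi_mul_div_eq_zero hh.ne' h0
    have hre := hu.1
    rw [mem_preimage, Complex.ofReal_re, hx₁] at hre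
    have hk0 : (0 : ℝ) < k := by
      by_contra hk
      nlinarith [hre.1]
    have hkN : (k : ℝ) < N + 1 := by
      by_contra hk
      nlinarith [hre.2]
    have hk0' : 0 < k := by exact_mod_cast hk0
    have hkN' : k < N + 1 := by exact_mod_cast hkN
    lift k to ℕ using hk0'.le
    exact h1 k (Finset.mem_Icc.2 ⟨by omega, by omega⟩) (by simp)
  have hfint : RectIntegrable (fun u => integrand T u z) x₀ x₁ (-a) a :=
    rectIntegrable_of_continuousAt hx (by linarith) fun u hu =>
      (hfd u hu.1 (fun h => hbd u hu (h ▸ hmp')) (fun h => hbd u hu (h ▸ hmm'))).continuousAt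
  have hfmint : RectIntegrable (fun u => integrand T u z * mFun h u) x₀ x₁ (-a) a :=
    rectIntegrable_of_continuousAt hx (by linarith) fun u hu =>
      (hfd u hu.1 (fun h => hbd u hu (h ▸ hmp')) (fun h => hbd u hu (h ▸ hmm'))).continuousAt.mul
        (hmd u hu.1 fun j hj h => hbd u hu (h ▸ hnode j hj)).continuousAt
  obtain ⟨hfμint, hD⟩ := rectIntegral_mul_muFun ha hfint
  have hres : ∀ w : ℂ, 0 < w.re → (w ^ 2).im ≠ 0 → Complex.exp (2 * (w - T)) + z = 0 →
      Tendsto (fun u => (u - w ^ 2) * (integrand T u z * mFun h u)) (𝓝[≠] (w ^ 2))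
        (𝓝 (-Complex.exp (w - T) / Real.pi * mFun h (w ^ 2))) := by
    intro w hw him hw0
    have h1 := tendsto_sub_mul_integrand (T := T) (z := z) (mem_slitPlane_sq hw) hz
      (by rwa [csqrt_of_sq hw])
    rw [csqrt_of_sq hw] at h1
    have h2 := (differentiableAt_mFun
      (sin_pi_mul_div_ne_zero_of_im hh.ne' him)).continuousAt.tendsto.mono_left
        (nhdsWithin_le_nhds (s := {w ^ 2}ᶜ))
    refine (h1.mul h2).congr fun u => ?_
    ring
  set nodes : Finset ℂ := (Finset.Icc 1 N).image fun j : ℕ => ((j * h : ℝ) : ℂ) with hnodes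
  have hpm : wp ^ 2 ≠ wm ^ 2 := fun he => by
    have h1 := hmp.2.1
    have h2 := hmm.2.2
    rw [he] at h1
    exact lt_asymm h1 h2
  have hdisj : Disjoint nodes {wp ^ 2, wm ^ 2} := by
    rw [Finset.disjoint_left]
    intro u hu hu'
    obtain ⟨j, -, rfl⟩ := Finset.mem_image.1 hu
    rw [Finset.mem_insert, Finset.mem_singleton] at hu'
    rcases hu' with hu' | hu'
    · have := hmp.2.1
      rw [← hu', Complex.ofReal_im] at this
      exact lt_irrefl _ this
    · have := hmm.2.2
      rw [← hu', Complex.ofReal_im] at this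
      exact lt_irrefl _ this
  -- A single residue function serves both kinds of poles of `f m`: the nodes are real, while the
  -- poles of `f` are not.
  have hC := rectIntegral_eq_sum_residues hx (by linarith : -a ≤ a) (nodes ∪ {wp ^ 2, wm ^ 2})
    (fun u => if u.im = 0 then integrand T u z * (-(Complex.I / 2) * (h / Real.pi))
      else -Complex.exp (Complex.sqrt u - T) / Real.pi * mFun h u)
    (fun u => integrand T u z * mFun h u) (by
      intro p hp
      simp only [hnodes, Finset.mem_union, Finset.mem_image, Finset.mem_insert,
        Finset.mem_singleton] at hp
      rcases hp with ⟨j, hj, rfl⟩ | rfl | rfl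
      · exact hnode j hj
      · exact hmp'
      · exact hmm') (by
      intro u hu hne
      simp only [hnodes, Finset.mem_union, Finset.mem_image, Finset.mem_insert,
        Finset.mem_singleton, not_or, not_exists, not_and] at hne
      exact (hfd u hu hne.2.1 hne.2.2).mul (hmd u hu fun j hj h => hne.1 j hj h.symm)) (by
      intro p hp
      simp only [hnodes, Finset.mem_union, Finset.mem_image, Finset.mem_insert,
        Finset.mem_singleton] at hp
      rcases hp with ⟨j, hj, rfl⟩ | rfl | rfl
      · rw [if_pos (Complex.ofReal_im _)]
        have hjmem := hnode j hj
        have hne : ∀ w : ℂ, (w ^ 2).im ≠ 0 → ((j * h : ℝ) : ℂ) ≠ w ^ 2 := fun w hw he =>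
          hw (he ▸ Complex.ofReal_im _)
        have h1 := (hfd _ ⟨Ioo_subset_Icc_self hjmem.1, Ioo_subset_Icc_self hjmem.2⟩
          (hne wp hmp.2.1.ne') (hne wm hmm.2.2.ne)).continuousAt.tendsto.mono_left
            (nhdsWithin_le_nhds (s := {((j * h : ℝ) : ℂ)}ᶜ))
        refine (h1.mul (tendsto_sub_mul_mFun hh.ne' j)).congr fun u => ?_
        ring
      · rw [if_neg hmp.2.1.ne', csqrt_of_sq hwp]
        exact hres wp hwp hmp.2.1.ne' hzp
      · rw [if_neg hmm.2.2.ne, csqrt_of_sq hwm]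
        exact hres wm hwm hmm.2.2.ne hzm)
  rw [Finset.sum_union hdisj, Finset.sum_pair hpm, if_neg hmp.2.1.ne', if_neg hmm.2.2.ne,
    csqrt_of_sq hwp, csqrt_of_sq hwm, hnodes, Finset.sum_image (by
      intro i _ j _ hij
      have : (i * h : ℝ) = j * h := Complex.ofReal_injective hij
      exact_mod_cast mul_right_cancel₀ hh.ne' this)] at hC
  simp only [Complex.ofReal_im, if_true] at hC
  rw [← Finset.sum_mul] at hC
  have hsplit : rectIntegral (fun u => integrand T u z * deltaFun h u) x₀ x₁ (-a) a =
      rectIntegral (fun u => integrand T u z * muFun u) x₀ x₁ (-a) a -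
        rectIntegral (fun u => integrand T u z * mFun h u) x₀ x₁ (-a) a := by
    rw [← rectIntegral_sub hfμint hfmint]
    congr 1
    funext u
    unfold deltaFun
    ring
  have hδp : deltaFun h (wp ^ 2) = -(1 / 2) - mFun h (wp ^ 2) := by
    rw [deltaFun, muFun, if_pos hmp.2.1.le]
  have hδm : deltaFun h (wm ^ 2) = 1 / 2 - mFun h (wm ^ 2) := by
    rw [deltaFun, muFun, if_neg (not_le.2 hmm.2.2)]
  -- The integrals over the half rectangles supply the `∓1/2` that completes `-m` to `δ` at the
  -- upper and the lower pole.
  rw [hsplit, hD, hA, hB, hC, hδp, hδm]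
  generalize ∑ j ∈ Finset.Icc 1 N, integrand T ((j * h : ℝ) : ℂ) z = Sg
  field_simp
  ring_nf
  simp only [Complex.I_sq]
  ring

end Contour

/-! ### The truncated integral by an explicit primitive -/

/-- The primitive of `t ↦ 2 a² / (π (t² + a²))` on the real line that vanishes at infinity, for
`a` in the right half plane. -/
def kernelPrimitive (a : ℂ) (t : ℝ) : ℂ :=
  a / (Real.pi * Complex.I) * (Complex.log (t - Complex.I * a) - Complex.log (t + Complex.I * a))

section Primitive

variable {a : ℂ}

/-- Partial fractions. As `Re a > 0`, neither `t - ia` nor `t + ia` meets the real axis, so the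
principal logarithm is smooth along both. -/
theorem hasDerivAt_kernelPrimitive (ha : 0 < a.re) (t : ℝ) :
    HasDerivAt (kernelPrimitive a) (2 / Real.pi * (a ^ 2 / ((t : ℂ) ^ 2 + a ^ 2))) t := by
  have hpi : (Real.pi : ℂ) ≠ 0 := by exact_mod_cast Real.pi_ne_zero
  have him1 : ((t : ℂ) - Complex.I * a).im ≠ 0 := by simpa using ha.ne'
  have him2 : ((t : ℂ) + Complex.I * a).im ≠ 0 := by simpa using ha.ne'
  have h1 : HasDerivAt (fun t : ℝ => (t - Complex.I * a : ℂ)) 1 t :=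
    ((hasDerivAt_id t).ofReal_comp).sub_const _
  have h2 : HasDerivAt (fun t : ℝ => (t + Complex.I * a : ℂ)) 1 t :=
    ((hasDerivAt_id t).ofReal_comp).add_const _
  have hn1 : (t : ℂ) - Complex.I * a ≠ 0 := fun h => him1 (by rw [h, Complex.zero_im])
  have hn2 : (t : ℂ) + Complex.I * a ≠ 0 := fun h => him2 (by rw [h, Complex.zero_im])
  have hprod : (t : ℂ) ^ 2 + a ^ 2 = (t - Complex.I * a) * (t + Complex.I * a) := by
    linear_combination a ^ 2 * Complex.I_sq
  refine (((h1.clog_real (Or.inr him1)).sub (h2.clog_real (Or.inr him2))).const_mul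
    (a / (Real.pi * Complex.I))).congr_deriv ?_
  rw [hprod, div_sub_div _ _ hn1 hn2]
  field_simp
  ring

theorem kernelPrimitive_zero (ha : 0 < a.re) : kernelPrimitive a 0 = -a := by
  have hpi : (Real.pi : ℂ) ≠ 0 := by exact_mod_cast Real.pi_ne_zero
  have him : 0 < (Complex.I * a).im := by simpa using ha
  rw [kernelPrimitive, Complex.ofReal_zero, zero_sub, zero_add, log_neg_of_im_pos him]
  field_simp
  ring

theorem norm_kernelPrimitive_le (ha : 0 < a.re) {t : ℝ} (ht : 0 < t) (hat : ‖a‖ ≤ t / 2) :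
    ‖kernelPrimitive a t‖ ≤ 3 / Real.pi * ‖a‖ ^ 2 / t := by
  have htC : (t : ℂ) ≠ 0 := by exact_mod_cast ht.ne'
  have hlog : ∀ s : ℂ, ‖s‖ = ‖a‖ → (t + s : ℂ) ≠ 0 →
      Complex.log (t + s) = Real.log t + Complex.log (1 + s / t) ∧
        ‖Complex.log (1 + s / t)‖ ≤ 3 / 2 * (‖a‖ / t) := by
    intro s hs hne
    have hst : ‖s / t‖ = ‖a‖ / t := by
      rw [norm_div, hs, Complex.norm_real, Real.norm_of_nonneg ht.le]
    have hfac : (t + s : ℂ) = t * (1 + s / t) := by field_simp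
    constructor
    · rw [hfac, Complex.log_ofReal_mul ht]
      intro h0
      rw [hfac, h0, mul_zero] at hne
      exact hne rfl
    · rw [← hst]
      refine Complex.norm_log_one_add_half_le_self ?_
      rw [hst, div_le_iff₀ ht]
      linarith
  obtain ⟨e1, b1⟩ := hlog (-(Complex.I * a)) (by simp) (by
    intro h
    have := congrArg Complex.im h
    simp at this
    exact ha.ne' this)
  obtain ⟨e2, b2⟩ := hlog (Complex.I * a) (by simp) (by
    intro h
    have := congrArg Complex.im h
    simp at this
    exact ha.ne' this)
  rw [kernelPrimitive, sub_eq_add_neg (t : ℂ), e1, e2, add_sub_add_left_eq_sub, norm_mul, norm_div,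
    norm_mul, Complex.norm_I, mul_one, Complex.norm_real, Real.norm_of_nonneg Real.pi_pos.le]
  calc ‖a‖ / Real.pi * _ ≤ ‖a‖ / Real.pi * (3 / 2 * (‖a‖ / t) + 3 / 2 * (‖a‖ / t)) := by
        gcongr
        exact (norm_sub_le _ _).trans (add_le_add b1 b2)
    _ = _ := by ring

theorem norm_kernelPrimitive_sub_le (ha : 0 < a.re) {t C : ℝ} (ht : 0 ≤ t)
    (hC : ∀ s : ℝ, 0 ≤ s → ‖(2 / Real.pi * (a ^ 2 / ((s : ℂ) ^ 2 + a ^ 2)) : ℂ)‖ ≤ C) :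
    ‖kernelPrimitive a t + a‖ ≤ C * t := by
  have := norm_image_sub_le_of_norm_deriv_le_segment' (a := 0) (b := t)
    (fun s _ => (hasDerivAt_kernelPrimitive ha s).hasDerivWithinAt)
    (fun s hs => hC s hs.1) t ⟨ht, le_rfl⟩
  rwa [kernelPrimitive_zero ha, sub_neg_eq_add, sub_zero] at this

theorem integrand_ofReal (T : ℝ) {x : ℝ} (hx : 0 ≤ x) (z : ℂ) :
    integrand T x z = z / Real.pi * (1 / (Real.sqrt x : ℂ)) *
      ((Real.exp (Real.sqrt x - T) : ℂ) / ((Real.exp (Real.sqrt x - T) : ℂ) ^ 2 + z)) := by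
  rw [integrand, csqrt_ofReal hx, Complex.ofReal_exp, ← Complex.exp_nat_mul]
  push_cast
  rfl

theorem integral_integrand (ha : 0 < a.re) (T : ℝ) {x₀ x₁ : ℝ} (hx₀ : 0 < x₀) (hx : x₀ ≤ x₁) :
    ∫ x in x₀..x₁, integrand T x (a ^ 2) =
      kernelPrimitive a (Real.exp (Real.sqrt x₁ - T)) -
        kernelPrimitive a (Real.exp (Real.sqrt x₀ - T)) := by
  have hpi : (Real.pi : ℂ) ≠ 0 := by exact_mod_cast Real.pi_ne_zero
  have hpos : ∀ x ∈ uIcc x₀ x₁, 0 < x := fun x hx' => by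
    rw [uIcc_of_le hx] at hx'
    exact hx₀.trans_le hx'.1
  have hne : ∀ t : ℝ, (t : ℂ) ^ 2 + a ^ 2 ≠ 0 := fun t h => by
    have hprod : (t : ℂ) ^ 2 + a ^ 2 = (t - Complex.I * a) * (t + Complex.I * a) := by
      linear_combination a ^ 2 * Complex.I_sq
    rw [hprod, mul_eq_zero] at h
    rcases h with h | h <;>
    · have := congrArg Complex.im h
      simp at this
      exact ha.ne' this
  refine intervalIntegral.integral_eq_sub_of_hasDerivAt
    (f := fun x => kernelPrimitive a (Real.exp (Real.sqrt x - T))) (fun x hx' => ?_) ?_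
  · have hx0 := hpos x hx'
    have hs : (Real.sqrt x : ℂ) ≠ 0 := by exact_mod_cast (Real.sqrt_pos.2 hx0).ne'
    have h1 : HasDerivAt (fun x => Real.exp (Real.sqrt x - T))
        (Real.exp (Real.sqrt x - T) * (1 / (2 * Real.sqrt x))) x :=
      ((Real.hasDerivAt_sqrt hx0.ne').sub_const T).exp
    refine ((hasDerivAt_kernelPrimitive ha _).scomp x h1).congr_deriv ?_
    have := hne (Real.exp (Real.sqrt x - T))
    rw [integrand_ofReal T hx0.le, Complex.real_smul]
    push_cast at this ⊢
    field_simp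
  · refine ContinuousOn.intervalIntegrable ?_
    have hcont : ContinuousOn (fun x : ℝ => a ^ 2 / Real.pi * (1 / (Real.sqrt x : ℂ)) *
        ((Real.exp (Real.sqrt x - T) : ℂ) / ((Real.exp (Real.sqrt x - T) : ℂ) ^ 2 + a ^ 2)))
        (uIcc x₀ x₁) := by
      have hs : ∀ x ∈ uIcc x₀ x₁, (Real.sqrt x : ℂ) ≠ 0 := fun x hx' => by
        exact_mod_cast (Real.sqrt_pos.2 (hpos x hx')).ne'
      refine ContinuousOn.mul (ContinuousOn.mul continuousOn_const
        (ContinuousOn.div continuousOn_const (by fun_prop) hs))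
        (ContinuousOn.div (by fun_prop) (by fun_prop) fun x _ => hne _)
    exact hcont.congr fun x hx' => integrand_ofReal T (hpos x hx').le _

end Primitive

section Polar

variable {r θ : ℝ}

theorem norm_polar (hr : 0 ≤ r) : ‖(r : ℂ) * Complex.exp (θ * Complex.I)‖ = r := by
  rw [norm_mul, Complex.norm_exp_ofReal_mul_I, mul_one, Complex.norm_real, Real.norm_of_nonneg hr]

theorem sqrt_polar_sq (hr : 0 ≤ r) :
    ((Real.sqrt r : ℂ) * Complex.exp ((θ / 2 : ℝ) * Complex.I)) ^ 2 =
      r * Complex.exp (θ * Complex.I) := by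
  rw [mul_pow, ← Complex.ofReal_pow, Real.sq_sqrt hr, ← Complex.exp_nat_mul]
  congr 2
  push_cast
  ring

theorem sqrt_polar_re_pos (hr : 0 < r) (hc : 0 < Real.cos (θ / 2)) :
    0 < ((Real.sqrt r : ℂ) * Complex.exp ((θ / 2 : ℝ) * Complex.I)).re := by
  rw [Complex.re_ofReal_mul, Complex.exp_ofReal_mul_I_re]
  exact mul_pos (Real.sqrt_pos.2 hr) hc

/-- The integral of `f` over a long interval approximates `√z`. -/
theorem norm_integral_integrand_sub_sqrt_le (hr : 0 < r) (hc : 0 < Real.cos (θ / 2)) {T x₀ x₁ : ℝ}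
    (hx₀ : 0 < x₀) (hx : x₀ ≤ x₁) (hrx : Real.sqrt r ≤ Real.exp (Real.sqrt x₁ - T) / 2) :
    ‖(∫ x in x₀..x₁, integrand T x (r * Complex.exp (θ * Complex.I))) -
        Complex.sqrt (r * Complex.exp (θ * Complex.I))‖ ≤
      2 / (Real.pi * Real.cos (θ / 2)) * Real.exp (Real.sqrt x₀ - T) +
        3 / Real.pi * r * Real.exp (-(Real.sqrt x₁ - T)) := by
  have ha := sqrt_polar_re_pos hr hc
  have hn : ‖(Real.sqrt r : ℂ) * Complex.exp ((θ / 2 : ℝ) * Complex.I)‖ = Real.sqrt r :=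
    norm_polar (Real.sqrt_nonneg r)
  rw [← sqrt_polar_sq hr.le, csqrt_of_sq ha, integral_integrand ha T hx₀ hx]
  have hd : ∀ s : ℝ, 0 ≤ s → ‖(2 / Real.pi *
      (((Real.sqrt r : ℂ) * Complex.exp ((θ / 2 : ℝ) * Complex.I)) ^ 2 / ((s : ℂ) ^ 2 +
        ((Real.sqrt r : ℂ) * Complex.exp ((θ / 2 : ℝ) * Complex.I)) ^ 2)) : ℂ)‖ ≤
      2 / (Real.pi * Real.cos (θ / 2)) := by
    intro s hs
    rw [sqrt_polar_sq hr.le, norm_mul, norm_div, norm_div, norm_polar hr.le, Complex.norm_real,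
      Real.norm_of_nonneg Real.pi_pos.le, Complex.norm_two, ← Complex.ofReal_pow]
    have h1 : Real.cos (θ / 2) * r ≤ ‖((s ^ 2 : ℝ) : ℂ) + r * Complex.exp (θ * Complex.I)‖ :=
      (mul_le_mul_of_nonneg_left (by nlinarith) hc.le).trans cos_mul_le_norm_add
    calc 2 / Real.pi * (r / _) ≤ 2 / Real.pi * (r / (Real.cos (θ / 2) * r)) := by gcongr
      _ = _ := by
        have := Real.pi_pos.ne'
        field_simp
  have h1 := norm_kernelPrimitive_le ha (Real.exp_pos (Real.sqrt x₁ - T)) (by rw [hn]; exact hrx)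
  have h2 := norm_kernelPrimitive_sub_le ha (Real.exp_pos (Real.sqrt x₀ - T)).le hd
  rw [hn, Real.sq_sqrt hr.le, div_eq_mul_inv _ (Real.exp _), ← Real.exp_neg] at h1
  rw [sub_sub, add_comm _ (3 / _ * _ * _)]
  exact (norm_sub_le _ _).trans (add_le_add h1 h2)

theorem div_sqrt_mul_exp_neg_sqrt_le {h : ℝ} (hh : 0 < h) (k : ℕ) :
    h / Real.sqrt ((k + 1 : ℕ) * h) * Real.exp (-Real.sqrt ((k + 1 : ℕ) * h)) ≤
      2 * (Real.exp (-Real.sqrt (k * h)) - Real.exp (-Real.sqrt ((k + 1 : ℕ) * h))) := by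
  set A := Real.sqrt (k * h) with hA
  set B := Real.sqrt ((k + 1 : ℕ) * h) with hB
  have hA2 : A ^ 2 = k * h := Real.sq_sqrt (by positivity)
  have hB2 : B ^ 2 = (k + 1) * h := by
    rw [hB, Real.sq_sqrt (by positivity)]
    push_cast
    rfl
  have hA0 : 0 ≤ A := Real.sqrt_nonneg _
  have hB0 : 0 < B := Real.sqrt_pos.2 (by positivity)
  have hAB : A ≤ B := Real.sqrt_le_sqrt (by push_cast; nlinarith)
  have h1 : h / B ≤ 2 * (B - A) := by
    rw [div_le_iff₀ hB0]
    nlinarith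
  have h2 : Real.exp (-B) * (B - A) ≤ Real.exp (-A) - Real.exp (-B) := by
    have h3 : Real.exp (-A) = Real.exp (-B) * Real.exp (B - A) := by
      rw [← Real.exp_add]
      congr 1
      ring
    have h4 := Real.add_one_le_exp (B - A)
    have h5 := Real.exp_pos (-B)
    rw [h3]
    nlinarith
  calc h / B * Real.exp (-B) ≤ 2 * (B - A) * Real.exp (-B) := by gcongr
    _ ≤ _ := by linarith

theorem sum_div_sqrt_mul_exp_neg_sqrt_le {h : ℝ} (hh : 0 < h) (N : ℕ) :
    ∑ j ∈ Finset.Icc 1 N, h / Real.sqrt (j * h) * Real.exp (-Real.sqrt (j * h)) ≤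
      2 * (1 - Real.exp (-Real.sqrt (N * h))) := by
  induction N with
  | zero => simp
  | succ k ih =>
    rw [Finset.sum_Icc_succ_top (by omega)]
    have := div_sqrt_mul_exp_neg_sqrt_le hh k
    linarith

theorem trapApprox_eq_sum_integrand {h : ℝ} (hh : 0 ≤ h) (N : ℕ) (z : ℂ) :
    trapApprox h N z =
      h * ∑ j ∈ Finset.Icc 1 N, integrand (truncT h N) ((j * h : ℝ) : ℂ) z := by
  rw [trapApprox, Finset.mul_sum, Finset.mul_sum]
  refine Finset.sum_congr rfl fun j _ => ?_
  rw [integrand_ofReal _ (by positivity), ← Complex.ofReal_pow, ← Real.exp_nat_mul,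
    show ((2 : ℕ) : ℝ) * (Real.sqrt (j * h) - truncT h N) =
      2 * Real.sqrt (j * h) - 2 * truncT h N by push_cast; ring]
  ring

theorem norm_integrand_node_le (hr : 0 ≤ r) (hc : 0 < Real.cos (θ / 2)) {T x : ℝ} (hx : 0 ≤ x) :
    ‖integrand T x (r * Complex.exp (θ * Complex.I))‖ ≤
      r * Real.exp T / (Real.pi * Real.cos (θ / 2)) *
        (1 / Real.sqrt x * Real.exp (-Real.sqrt x)) := by
  rw [integrand_ofReal T hx, norm_mul, norm_mul, norm_div, norm_div, norm_div, norm_polar hr,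
    norm_one, Complex.norm_real, Complex.norm_real, Complex.norm_real,
    Real.norm_of_nonneg Real.pi_pos.le, Real.norm_of_nonneg (Real.sqrt_nonneg x),
    Real.norm_of_nonneg (Real.exp_pos _).le, ← Complex.ofReal_pow]
  set t := Real.exp (Real.sqrt x - T) with ht
  have ht0 : 0 < t := Real.exp_pos _
  have h1 : Real.cos (θ / 2) * t ^ 2 ≤ ‖((t ^ 2 : ℝ) : ℂ) + r * Complex.exp (θ * Complex.I)‖ :=
    (mul_le_mul_of_nonneg_left (by linarith) hc.le).trans cos_mul_le_norm_add
  have h2 : t / (Real.cos (θ / 2) * t ^ 2) =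
      Real.exp T * Real.exp (-Real.sqrt x) / Real.cos (θ / 2) := by
    rw [← Real.exp_add, show T + -Real.sqrt x = -(Real.sqrt x - T) by ring, Real.exp_neg, ← ht]
    field_simp
  calc r / Real.pi * (1 / Real.sqrt x) * (t / _)
      ≤ r / Real.pi * (1 / Real.sqrt x) * (t / (Real.cos (θ / 2) * t ^ 2)) := by gcongr
    _ = _ := by
      rw [h2]
      have := Real.pi_pos.ne'
      field_simp

/-- The trapezoidal approximant is small for small arguments. -/
theorem norm_trapApprox_le (hr : 0 ≤ r) (hc : 0 < Real.cos (θ / 2)) {h : ℝ} (hh : 0 < h) (N : ℕ) :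
    ‖trapApprox h N (r * Complex.exp (θ * Complex.I))‖ ≤
      2 * r * Real.exp (truncT h N) / (Real.pi * Real.cos (θ / 2)) := by
  set K := r * Real.exp (truncT h N) / (Real.pi * Real.cos (θ / 2)) with hK
  have hK0 : 0 ≤ K := by positivity
  rw [trapApprox_eq_sum_integrand hh.le, norm_mul, Complex.norm_real, Real.norm_of_nonneg hh.le]
  calc h * _ ≤ h * ∑ j ∈ Finset.Icc 1 N,
        K * (1 / Real.sqrt (j * h) * Real.exp (-Real.sqrt (j * h))) := by
        refine mul_le_mul_of_nonneg_left ((norm_sum_le _ _).trans (Finset.sum_le_sum fun j _ => ?_))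
          hh.le
        exact norm_integrand_node_le hr hc (by positivity)
    _ = K * ∑ j ∈ Finset.Icc 1 N, h / Real.sqrt (j * h) * Real.exp (-Real.sqrt (j * h)) := by
        rw [Finset.mul_sum, Finset.mul_sum]
        refine Finset.sum_congr rfl fun j _ => ?_
        ring
    _ ≤ K * 2 := by
        refine mul_le_mul_of_nonneg_left ((sum_div_sqrt_mul_exp_neg_sqrt_le hh N).trans ?_) hK0
        have := Real.exp_pos (-Real.sqrt (N * h))
        linarith
    _ = _ := by rw [hK]; ring

end Polar

section Poles

variable {τ b : ℝ}

theorem complex_sq_im (w : ℂ) : (w ^ 2).im = 2 * w.re * w.im := by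
  rw [sq, Complex.mul_im]
  ring

theorem complex_sq_re (w : ℂ) : (w ^ 2).re = w.re ^ 2 - w.im ^ 2 := by
  rw [sq, Complex.mul_re]
  ring

/-- The real part of a pole `w²` of `f` lies in the range of the rectangle. -/
theorem pole_re_mem {β T x₁ : ℝ} (hβ : β ∈ Ico (0 : ℝ) 2) (hτ : 2 + β ≤ τ) (hτT : τ ≤ T)
    (hx₁ : x₁ = 4 * T ^ 2 + 1 - β / 2) {w : ℂ} (hre : w.re = τ)
    (him : |w.im| ≤ Real.pi / 4 * (2 + β)) : (w ^ 2).re ∈ Ioo (1 - β / 2) x₁ := by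
  obtain ⟨hβ0, hβ2⟩ := hβ
  have hpi := Real.pi_lt_d2
  have hpi0 := Real.pi_pos
  rw [complex_sq_re, hre, hx₁]
  have h1 : w.im ^ 2 ≤ (Real.pi / 4 * (2 + β)) ^ 2 := sq_le_sq.2 (by
    rwa [abs_of_nonneg (by positivity : 0 ≤ Real.pi / 4 * (2 + β))])
  have h2 : (Real.pi / 4) ^ 2 ≤ 0.625 := by nlinarith
  have h3 : (2 + β) ^ 2 ≤ τ ^ 2 := by gcongr
  have h4 : τ ^ 2 ≤ T ^ 2 := by gcongr; linarith
  have h5 : (Real.pi / 4 * (2 + β)) ^ 2 ≤ 0.625 * (2 + β) ^ 2 := by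
    rw [mul_pow]
    gcongr
  have h6 : (4 : ℝ) ≤ (2 + β) ^ 2 := by nlinarith
  constructor
  · nlinarith
  · nlinarith [sq_nonneg w.im, sq_nonneg T]

theorem exp_pole {r T θ : ℝ} (hr : 0 < r) {w : ℂ} (k : ℤ)
    (hw : 2 * (w - T) = (Real.log r : ℂ) + θ * Complex.I + Real.pi * Complex.I
      + k * (2 * Real.pi * Complex.I)) :
    Complex.exp (2 * (w - T)) + r * Complex.exp (θ * Complex.I) = 0 := by
  rw [hw, Complex.exp_add, Complex.exp_add, Complex.exp_add, Complex.exp_pi_mul_I,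
    Complex.exp_int_mul_two_pi_mul_I, ← Complex.ofReal_exp, Real.exp_log hr]
  ring

/-- Only two poles of `f` have imaginary part at most `2πτ` in absolute value. -/
theorem pole_unique {T : ℝ} {z wp wm u : ℂ} (hτ : 0 < τ) (hb : |b| < Real.pi / 2)
    (hwp : wp = τ + ((b + Real.pi / 2 : ℝ) : ℂ) * Complex.I)
    (hwm : wm = τ + ((b - Real.pi / 2 : ℝ) : ℂ) * Complex.I)
    (hzp : Complex.exp (2 * (wp - T)) + z = 0)
    (hu : u.im ∈ Icc (-(2 * Real.pi * τ)) (2 * Real.pi * τ))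
    (h0 : Complex.exp (2 * (Complex.sqrt u - T)) + z = 0) : u = wp ^ 2 ∨ u = wm ^ 2 := by
  obtain ⟨hb1, hb2⟩ := abs_lt.1 hb
  have hpi := Real.pi_pos
  have he : Complex.exp (2 * (Complex.sqrt u - T)) = Complex.exp (2 * (wp - T)) := by
    rw [eq_neg_of_add_eq_zero_left h0, eq_neg_of_add_eq_zero_left hzp]
  obtain ⟨n, hn⟩ := Complex.exp_eq_exp_iff_exists_int.1 he
  have hs : Complex.sqrt u = τ + ((b + Real.pi / 2 + n * Real.pi : ℝ) : ℂ) * Complex.I := by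
    rw [hwp] at hn
    push_cast at hn ⊢
    linear_combination hn / 2
  have hre : (Complex.sqrt u).re = τ := by rw [hs]; simp
  have him : (Complex.sqrt u).im = b + Real.pi / 2 + n * Real.pi := by
    rw [hs, Complex.add_im, Complex.im_ofReal_mul, Complex.ofReal_im, Complex.I_im]
    ring
  have hui : u.im = 2 * τ * (b + Real.pi / 2 + n * Real.pi) := by
    rw [← csqrt_sq u, complex_sq_im, hre, him]
  rw [hui] at hu
  have h1 : b + Real.pi / 2 + n * Real.pi ≤ Real.pi := by
    by_contra hlt
    push Not at hlt
    nlinarith [hu.2, mul_lt_mul_of_pos_left hlt hτ]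
  have h2 : -Real.pi ≤ b + Real.pi / 2 + n * Real.pi := by
    by_contra hlt
    push Not at hlt
    nlinarith [hu.1, mul_lt_mul_of_pos_left hlt hτ]
  have hn1 : (n : ℝ) < 1 := by
    by_contra hlt
    push Not at hlt
    nlinarith
  have hn2 : (-2 : ℝ) < n := by
    by_contra hlt
    push Not at hlt
    nlinarith
  have hn1' : n < 1 := by exact_mod_cast hn1
  have hn2' : -2 < n := by exact_mod_cast hn2
  obtain rfl | rfl : n = 0 ∨ n = -1 := by omega
  · left
    rw [← csqrt_sq u, hs, hwp]
    simp
  · right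
    rw [← csqrt_sq u, hs, hwm]
    congr 3
    push_cast
    ring

/-- The contribution of a single pole of `f` to the quadrature error. -/
theorem norm_pole_contribution_le {β τ T : ℝ} (hβ : β < 2) (hτ : 1 ≤ τ) {w : ℂ} (hre : w.re = τ)
    (him : Real.pi / 4 * (2 - β) ≤ |w.im|) :
    ‖2 * Complex.I * Complex.exp (w - T) * deltaFun (stepSize β) (w ^ 2)‖ ≤
      4 * Real.exp (-T) := by
  have hpi := Real.pi_pos
  have hβ' : 0 < 2 - β := by linarith
  have hτ0 : 0 < τ := by linarith
  have him0 : w.im ≠ 0 := abs_pos.1 (lt_of_lt_of_le (by positivity) him)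
  have hδ : ‖deltaFun (stepSize β) (w ^ 2)‖ ≤ 2 * Real.exp (-τ) := by
    have hh : 0 < stepSize β := mul_pos hβ' (by positivity)
    refine norm_deltaFun_le hh ?_ ?_ hτ
    · rw [complex_sq_im, hre]
      exact mul_ne_zero (by positivity) him0
    · rw [complex_sq_im, hre, abs_mul, abs_of_pos (by positivity : 0 < 2 * τ), stepSize]
      calc τ * ((2 - β) * Real.pi ^ 2)
          = 2 * Real.pi * (2 * τ * (Real.pi / 4 * (2 - β))) := by ring
        _ ≤ _ := by gcongr
  rw [norm_mul, norm_mul, norm_mul, Complex.norm_two, Complex.norm_I, Complex.norm_exp,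
    Complex.sub_re, hre, Complex.ofReal_re]
  calc 2 * 1 * Real.exp (τ - T) * ‖deltaFun (stepSize β) (w ^ 2)‖
      ≤ 2 * 1 * Real.exp (τ - T) * (2 * Real.exp (-τ)) := by gcongr
    _ = 4 * (Real.exp (τ - T) * Real.exp (-τ)) := by ring
    _ = _ := by
      rw [← Real.exp_add]
      ring_nf

end Poles

/-- The quadrature error is controlled by the contour term. -/
theorem norm_trapApprox_sub_integral_le {β : ℝ} (hβ : β ∈ Ico (0 : ℝ) 2) {N : ℕ} {r θ : ℝ}
    (hθ : |θ| = β * Real.pi / 2)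
    (hr : r ∈ Icc (Real.exp (4 + 2 * β - 2 * truncT (stepSize β) N)) 1) :
    ‖trapApprox (stepSize β) N (r * Complex.exp (θ * Complex.I)) -
        ∫ x in (1 - β / 2)..(4 * truncT (stepSize β) N ^ 2 + 1 - β / 2),
          integrand (truncT (stepSize β) N) x (r * Complex.exp (θ * Complex.I))‖ ≤
      ‖contourTerm β N r (r * Complex.exp (θ * Complex.I))‖ +
        8 * Real.exp (-truncT (stepSize β) N) := by
  obtain ⟨hβ0, hβ2⟩ := hβ
  have hpi := Real.pi_pos
  have hr0 : 0 < r := (Real.exp_pos _).trans_le hr.1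
  set h := stepSize β with hh_def
  have hh : 0 < h := mul_pos (by linarith) (by positivity)
  set T := truncT h N with hT
  have hT2 : 4 * T ^ 2 = N * h := by
    rw [hT, truncT, Real.sq_sqrt (by positivity)]
    ring
  set τ := T + 1 / 2 * Real.log r with hτ_def
  have hτ : 2 + β ≤ τ := by
    have := (Real.le_log_iff_exp_le hr0).2 hr.1
    linarith
  have hτT : τ ≤ T := by
    have := Real.log_nonpos hr0.le hr.2
    linarith
  have hτ0 : 0 < τ := by linarith
  set b := θ / 2 with hb_def
  have hb_le : |b| = Real.pi / 4 * β := by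
    rw [hb_def, abs_div, hθ, abs_two]
    ring
  have hb : |b| < Real.pi / 2 := by
    rw [hb_le]
    nlinarith
  obtain ⟨hbl, hbu⟩ := abs_le.1 hb_le.le
  obtain ⟨hbl', hbu'⟩ := abs_lt.1 hb
  set z : ℂ := r * Complex.exp (θ * Complex.I) with hz_def
  have hz : z ≠ 0 := mul_ne_zero (by exact_mod_cast hr0.ne') (Complex.exp_ne_zero _)
  obtain ⟨wp, hwp⟩ : ∃ wp : ℂ, wp = τ + ((b + Real.pi / 2 : ℝ) : ℂ) * Complex.I := ⟨_, rfl⟩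
  obtain ⟨wm, hwm⟩ : ∃ wm : ℂ, wm = τ + ((b - Real.pi / 2 : ℝ) : ℂ) * Complex.I := ⟨_, rfl⟩
  have hwp_re : wp.re = τ := by rw [hwp]; simp
  have hwm_re : wm.re = τ := by rw [hwm]; simp
  have hwp_im : wp.im = b + Real.pi / 2 := by
    rw [hwp, Complex.add_im, Complex.im_ofReal_mul, Complex.ofReal_im, Complex.I_im]
    ring
  have hwm_im : wm.im = b - Real.pi / 2 := by
    rw [hwm, Complex.add_im, Complex.im_ofReal_mul, Complex.ofReal_im, Complex.I_im]
    ring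
  have hzp : Complex.exp (2 * (wp - T)) + z = 0 := exp_pole hr0 0 (by
    rw [hwp, hτ_def, hb_def]
    push_cast
    ring)
  have hzm : Complex.exp (2 * (wm - T)) + z = 0 := exp_pole hr0 (-1) (by
    rw [hwm, hτ_def, hb_def]
    push_cast
    ring)
  have hmp : wp ^ 2 ∈ Ioo (1 - β / 2) (4 * T ^ 2 + 1 - β / 2) ×ℂ Ioo 0 (2 * Real.pi * τ) := by
    refine ⟨pole_re_mem ⟨hβ0, hβ2⟩ hτ hτT rfl hwp_re (by rw [hwp_im, abs_le]; constructor <;>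
      linarith), ?_⟩
    rw [mem_preimage, complex_sq_im, hwp_re, hwp_im]
    have h1 : 0 < 2 * τ * (b + Real.pi / 2) := mul_pos (by linarith) (by linarith)
    have h2 : 0 < 2 * τ * (Real.pi / 2 - b) := mul_pos (by linarith) (by linarith)
    constructor <;> linarith
  have hmm : wm ^ 2 ∈ Ioo (1 - β / 2) (4 * T ^ 2 + 1 - β / 2) ×ℂ Ioo (-(2 * Real.pi * τ)) 0 := by
    refine ⟨pole_re_mem ⟨hβ0, hβ2⟩ hτ hτT rfl hwm_re (by rw [hwm_im, abs_le]; constructor <;>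
      linarith), ?_⟩
    rw [mem_preimage, complex_sq_im, hwm_re, hwm_im]
    have h1 : 0 < 2 * τ * (b + Real.pi / 2) := mul_pos (by linarith) (by linarith)
    have h2 : 0 < 2 * τ * (Real.pi / 2 - b) := mul_pos (by linarith) (by linarith)
    constructor <;> linarith
  have hx₀h : 1 - β / 2 < h := by
    rw [hh_def, stepSize]
    nlinarith [Real.pi_gt_three]
  have hmain := rectIntegral_integrand_mul_deltaFun hh (by linarith : 0 < 1 - β / 2) hx₀h
    (by rw [hT2]; ring) hz (by rw [hwp_re]; exact hτ0) hmp hzp (by rw [hwm_re]; exact hτ0) hmm hzm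
    (fun u hu h0 => pole_unique hτ0 hb hwp hwm hzp hu.2 h0)
  have hct : contourTerm β N r z = rectIntegral (fun u => integrand T u z * deltaFun h u)
    (1 - β / 2) (4 * T ^ 2 + 1 - β / 2) (-(2 * Real.pi * τ)) (2 * Real.pi * τ) := rfl
  rw [← hct, ← trapApprox_eq_sum_integrand hh.le] at hmain
  have hp := norm_pole_contribution_le hβ2 (by linarith) (T := T) hwp_re (by
    rw [hwp_im]
    exact le_trans (by linarith) (le_abs_self _))
  have hm := norm_pole_contribution_le hβ2 (by linarith) (T := T) hwm_re (by
    rw [hwm_im]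
    exact le_trans (by linarith) (neg_le_abs _))
  have hEq : trapApprox h N z - ∫ x in (1 - β / 2)..(4 * T ^ 2 + 1 - β / 2), integrand T x z =
      -contourTerm β N r z - 2 * Complex.I * Complex.exp (wp - T) * deltaFun h (wp ^ 2)
        - 2 * Complex.I * Complex.exp (wm - T) * deltaFun h (wm ^ 2) := by
    rw [hmain]
    ring
  rw [hEq]
  refine (norm_sub_le _ _).trans ?_
  refine (add_le_add (norm_sub_le _ _) le_rfl).trans ?_
  rw [norm_neg]
  linarith

/-- The error estimate away from the origin, in terms of the contour term. -/
theorem norm_trapApprox_sub_sqrt_le {β : ℝ} (hβ : β ∈ Ico (0 : ℝ) 2) {N : ℕ} {r θ : ℝ}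
    (hθ : |θ| = β * Real.pi / 2) (hc : 0 < Real.cos (θ / 2))
    (hr : r ∈ Icc (Real.exp (4 + 2 * β - 2 * truncT (stepSize β) N)) 1) :
    ‖trapApprox (stepSize β) N (r * Complex.exp (θ * Complex.I)) -
        Complex.sqrt (r * Complex.exp (θ * Complex.I))‖ ≤
      ‖contourTerm β N r (r * Complex.exp (θ * Complex.I))‖ +
        (8 + 2 / (Real.pi * Real.cos (θ / 2)) * Real.exp 1 + 3 / Real.pi) *
          Real.exp (-truncT (stepSize β) N) := by
  have hq := norm_trapApprox_sub_integral_le hβ hθ hr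
  obtain ⟨hβ0, hβ2⟩ := hβ
  have hr0 : 0 < r := (Real.exp_pos _).trans_le hr.1
  set T := truncT (stepSize β) N with hT
  have hT0 : 0 ≤ T := Real.sqrt_nonneg _
  have hT2 : 2 ≤ T := by
    have := Real.exp_le_one_iff.1 (hr.1.trans hr.2)
    linarith
  have hx₁ : T ≤ Real.sqrt (4 * T ^ 2 + 1 - β / 2) - T := by
    have : 2 * T ≤ Real.sqrt (4 * T ^ 2 + 1 - β / 2) := Real.le_sqrt_of_sq_le (by nlinarith)
    linarith
  have hx₀ : Real.sqrt (1 - β / 2) ≤ 1 := Real.sqrt_le_one.2 (by linarith)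
  have hi := norm_integral_integrand_sub_sqrt_le hr0 hc (T := T) (x₀ := 1 - β / 2)
    (x₁ := 4 * T ^ 2 + 1 - β / 2) (by linarith) (by nlinarith) (by
      have h1 : Real.sqrt r ≤ 1 := Real.sqrt_le_one.2 hr.2
      have h2 := Real.add_one_le_exp (Real.sqrt (4 * T ^ 2 + 1 - β / 2) - T)
      linarith)
  have e1 : Real.exp (Real.sqrt (1 - β / 2) - T) ≤ Real.exp 1 * Real.exp (-T) := by
    rw [← Real.exp_add, Real.exp_le_exp]
    linarith
  have e2 : Real.exp (-(Real.sqrt (4 * T ^ 2 + 1 - β / 2) - T)) ≤ Real.exp (-T) := by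
    rw [Real.exp_le_exp]
    linarith
  have hpi := Real.pi_pos
  have b1 : 2 / (Real.pi * Real.cos (θ / 2)) * Real.exp (Real.sqrt (1 - β / 2) - T) ≤
      2 / (Real.pi * Real.cos (θ / 2)) * (Real.exp 1 * Real.exp (-T)) := by gcongr
  have b2 : 3 / Real.pi * r * Real.exp (-(Real.sqrt (4 * T ^ 2 + 1 - β / 2) - T)) ≤
      3 / Real.pi * 1 * Real.exp (-T) := by
    gcongr
    exact hr.2
  have := norm_sub_le_norm_sub_add_norm_sub (trapApprox (stepSize β) N
    (r * Complex.exp (θ * Complex.I))) (∫ x in (1 - β / 2)..(4 * T ^ 2 + 1 - β / 2),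
      integrand T x (r * Complex.exp (θ * Complex.I)))
    (Complex.sqrt (r * Complex.exp (θ * Complex.I)))
  linarith

/-- The error estimate near the origin. -/
theorem norm_trapApprox_sub_sqrt_le_of_small {β : ℝ} (hβ : β < 2) {N : ℕ} {r θ : ℝ}
    (hc : 0 < Real.cos (θ / 2)) (hr0 : 0 ≤ r)
    (hr : r ≤ Real.exp (4 + 2 * β - 2 * truncT (stepSize β) N)) :
    ‖trapApprox (stepSize β) N (r * Complex.exp (θ * Complex.I)) -
        Complex.sqrt (r * Complex.exp (θ * Complex.I))‖ ≤
      (2 * Real.exp (4 + 2 * β) / (Real.pi * Real.cos (θ / 2)) + Real.exp (2 + β)) *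
          Real.exp (-truncT (stepSize β) N) := by
  have hpi := Real.pi_pos
  have hh : 0 < stepSize β := mul_pos (by linarith) (by positivity)
  have h1 := norm_trapApprox_le hr0 hc hh N
  set T := truncT (stepSize β) N
  have h2 : ‖Complex.sqrt (r * Complex.exp (θ * Complex.I))‖ ≤ Real.exp (2 + β) * Real.exp (-T) := by
    refine le_of_sq_le_sq ?_ (by positivity)
    rw [← norm_pow, csqrt_sq, norm_polar hr0, ← Real.exp_add, ← Real.exp_nat_mul]
    refine hr.trans_eq ?_
    congr 1
    push_cast
    ring
  have h3 : 2 * r * Real.exp T / (Real.pi * Real.cos (θ / 2)) ≤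
      2 * Real.exp (4 + 2 * β) / (Real.pi * Real.cos (θ / 2)) * Real.exp (-T) := by
    have h4 : r * Real.exp T ≤ Real.exp (4 + 2 * β) * Real.exp (-T) := by
      calc r * Real.exp T ≤ Real.exp (4 + 2 * β - 2 * T) * Real.exp T := by gcongr
        _ = _ := by
          rw [← Real.exp_add, ← Real.exp_add]
          ring_nf
    calc 2 * r * Real.exp T / (Real.pi * Real.cos (θ / 2))
        = 2 / (Real.pi * Real.cos (θ / 2)) * (r * Real.exp T) := by ring
      _ ≤ 2 / (Real.pi * Real.cos (θ / 2)) * (Real.exp (4 + 2 * β) * Real.exp (-T)) := by gcongr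
      _ = _ := by ring
  refine (norm_sub_le _ _).trans ?_
  linarith

end TrapSqrt

end

theorem mainTheorem5 (β : ℝ) (hβ : β ∈ Set.Ico (0 : ℝ) 2)
    (hbound : TrapSqrt.ContourBound β) :
    ∃ C : ℝ, ∃ N₀ : ℕ, ∀ N : ℕ, N₀ ≤ N → ∀ z ∈ TrapSqrt.vDomain β,
      ‖TrapSqrt.trapApprox (TrapSqrt.stepSize β) N z - Complex.sqrt z‖
          ≤ C * Real.exp (-Real.sqrt (N * TrapSqrt.stepSize β / 4)) ∧
      ‖TrapSqrt.trapApprox (TrapSqrt.stepSize β) N z - Complex.sqrt z‖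
          ≤ C * Real.exp (-(Real.pi * Real.sqrt ((2 - β) * N / 4))) := by
  obtain ⟨C, N₀, hC⟩ := hbound
  have hpi := Real.pi_pos
  set c := Real.cos (β * Real.pi / 2 / 2) with hc_def
  have hc : 0 < c := Real.cos_pos_of_mem_Ioo ⟨by nlinarith [hβ.1], by nlinarith [hβ.2]⟩
  have hβπ : 0 ≤ β * Real.pi / 2 := div_nonneg (mul_nonneg hβ.1 hpi.le) zero_le_two
  set C₁ := 8 + 2 / (Real.pi * c) * Real.exp 1 + 3 / Real.pi with hC₁
  set C₂ := 2 * Real.exp (4 + 2 * β) / (Real.pi * c) + Real.exp (2 + β) with hC₂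
  refine ⟨max (C + C₁) C₂, N₀, fun N hN z hz => ?_⟩
  have hroot : Real.pi * Real.sqrt ((2 - β) * N / 4) =
      Real.sqrt (N * TrapSqrt.stepSize β / 4) := by
    rw [TrapSqrt.stepSize, show N * ((2 - β) * Real.pi ^ 2) / 4 =
      Real.pi ^ 2 * ((2 - β) * N / 4) by ring, Real.sqrt_mul (sq_nonneg _), Real.sqrt_sq hpi.le]
  rw [hroot, and_self]
  obtain ⟨r, hr, hz⟩ := hz
  obtain ⟨θ, hθ, hcos, hzθ⟩ : ∃ θ : ℝ, |θ| = β * Real.pi / 2 ∧ Real.cos (θ / 2) = c ∧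
      z = r * Complex.exp (θ * Complex.I) := by
    rcases hz with hz | hz
    · exact ⟨β * Real.pi / 2, abs_of_nonneg hβπ, rfl, hz⟩
    · refine ⟨-(β * Real.pi / 2), by rw [abs_neg, abs_of_nonneg hβπ], ?_, ?_⟩
      · rw [neg_div, Real.cos_neg]
      · rw [Complex.ofReal_neg]
        exact hz
  have hexp := Real.exp_pos (-TrapSqrt.truncT (TrapSqrt.stepSize β) N)
  change _ ≤ max (C + C₁) C₂ * Real.exp (-TrapSqrt.truncT (TrapSqrt.stepSize β) N)
  rcases le_total (Real.exp (4 + 2 * β - 2 * TrapSqrt.truncT (TrapSqrt.stepSize β) N)) r with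
    hle | hle
  · have h1 := hC N hN r ⟨hle, hr.2⟩ z hz
    have h2 := TrapSqrt.norm_trapApprox_sub_sqrt_le hβ hθ (hcos ▸ hc) ⟨hle, hr.2⟩
    rw [hcos, ← hzθ, ← hC₁] at h2
    calc _ ≤ (C + C₁) * Real.exp (-TrapSqrt.truncT (TrapSqrt.stepSize β) N) := by linarith
      _ ≤ _ := mul_le_mul_of_nonneg_right (le_max_left _ _) hexp.le
  · have h2 := TrapSqrt.norm_trapApprox_sub_sqrt_le_of_small hβ.2 (hcos ▸ hc) hr.1 hle
    rw [hcos, ← hzθ, ← hC₂] at h2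
    exact h2.trans (mul_le_mul_of_nonneg_right (le_max_right _ _) hexp.le)
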